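/- Notation. For a group $G$ put $\gamma_1G=G$, $\gamma_{n+1}G=[\gamma_nG,G]$, and $[a,b]=a^{-1}b^{-1}ab$. Let $F$ be a free group of finite rank, $A\subseteq F$ a finite set, $R$ the normal closure of $A$ in $F$, and $G\cong F/R$. The $R$-basic commutators are produced by the following process. Weight 1. Choose free generators $x_1,\dots,x_m$ of $F$ and free generators $y_1,\dots,y_s,z_1,\dots,z_t$ of the subgroup $H_1=\langle A\rangle$ in diagonal form: $s\le m$, and there are integers $d_i>0$ with $d_1\mid d_2\mid\dots\mid d_s$ such that $y_i\equiv x_i^{d_i}$ and $z_i\equiv 1$ modulo $\gamma_2F$. Put $R_1=\{y_1,\dots,y_s\}$. From weight $n$ to weight $n+1$. Let $y_1,\dots,y_s,z_1,\dots,z_t$ be the elements chosen in weight $n$, and let $H_{n+1}$ be the subgroup of $F$ generated by all the $z_i$ and all the commutators $[y_i,x_j]$ $(1\le i\le s,\ 1\le j\le m)$, where $x_1,\dots,x_m$ are the free generators of $F$ chosen in weight 1. Choose generators $y'_1,\dots,y'_{s'},z'_1,\dots,z'_{t'}$ of $H_{n+1}$ and elements $x'_1,\dots,x'_{m'}$ of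 $\gamma_{n+1}F$ whose classes freely generate the free abelian group $\gamma_{n+1}F/\gamma_{n+2}F$, in diagonal form: $s'\le m'$, and there are integers $d'_i>0$ with $d'_1\mid\dots\mid d'_{s'}$ such that $y'_i\equiv (x'_i)^{d'_i}$ and $z'_i\equiv1$ modulo $\gamma_{n+2}F$. Put $R_{n+1}=\{y'_1,\dots,y'_{s'}\}$. The elements of $R_n$ are called the $R$-basic commutators of weight $n$. Theorem. (a) The choices in weight 1 are possible; and after any choices up to weight $n$ have been made, the choices in weight $n+1$ are possible. (b) However the choices are made, for every $i\ge1$ the elements of $R_i$ lie in $R\cap\gamma_iF$, and their classes are pairwise distinct and freely generate the group $(R\cap\gamma_iF)/(R\cap\gamma_{i+1}F)$ as a free abelian group. (c) For every $i\ge1$ the homomorphism $(R\cap\gamma_iF)/(R\cap\gamma_{i+1}F)\to\gamma_iF/\gamma_{i+1}F$ induced by inclusion is injective, and, regarding it as an inclusion, the projection $F\to F/R\cong G$ induces an isomorphism $$\frac{\gamma_iF/\gamma_{i+1}F}{(R\cap\gamma_iF)/(R\cap\gamma_{i+1}F)}\;\cong\;\frac{\gamma_iG}{\gamma_{i+1}G}.$$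 -/

import Mathlib

/-- The lower central series with the classical indexing: `gam G 1 = G` and
`gam G (n + 1) = [gam G n, G]` for `n ≥ 1` (the value at `0` is again `G`; only `n ≥ 1` is used). -/
abbrev gam (G : Type*) [Group G] (n : ℕ) : Subgroup G :=
  (⊤ : Subgroup G).lowerCentralSeries (n - 1)

/-- The commutator `[a, b] = a⁻¹ b⁻¹ a b`. -/
def leftComm {G : Type*} [Group G] (a b : G) : G := a⁻¹ * b⁻¹ * a * b

/-- The `n`-th lower central factor `γ_n G / γ_{n+1} G`. -/
abbrev LowerCentralFactor (G : Type*) [Group G] (n : ℕ) : Type _ :=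
  gam G n ⧸ (gam G (n + 1)).subgroupOf (gam G n)

/-- The group `(R ∩ γ_n F) / (R ∩ γ_{n+1} F)`. -/
abbrev RelFactor {F : Type*} [Group F] (R : Subgroup F) (n : ℕ) : Type _ :=
  (R ⊓ gam F n : Subgroup F) ⧸ (R ⊓ gam F (n + 1)).subgroupOf (R ⊓ gam F n)

/-- The lower central factors are abelian. -/
instance LowerCentralFactor.commGroup (G : Type*) [Group G] (n : ℕ) :
    CommGroup (LowerCentralFactor G n) where
  mul_comm := by
    intro a b
    obtain ⟨a, rfl⟩ := QuotientGroup.mk_surjective a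
    obtain ⟨b, rfl⟩ := QuotientGroup.mk_surjective b
    rw [← QuotientGroup.mk_mul, ← QuotientGroup.mk_mul, QuotientGroup.eq,
      Subgroup.mem_subgroupOf]
    rcases n with _ | n
    · exact Subgroup.mem_top _
    · have h := Subgroup.commutator_mem_commutator (inv_mem b.2)
        (Subgroup.mem_top ((a : G)⁻¹))
      rw [commutatorElement_def] at h
      change ((a : G) * b)⁻¹ * ((b : G) * a) ∈ ⁅gam G (n + 1), (⊤ : Subgroup G)⁆
      rw [mul_inv_rev]
      simpa only [inv_inv, mul_assoc] using h

/-- The homomorphism `(R ∩ γ_n F)/(R ∩ γ_{n+1} F) → γ_n F/γ_{n+1} F` induced by inclusion. -/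
def relFactorIncl {F : Type*} [Group F] (R : Subgroup F) [R.Normal] (n : ℕ) :
    RelFactor R n →* LowerCentralFactor F n :=
  QuotientGroup.map _ _ (Subgroup.inclusion (inf_le_right : R ⊓ gam F n ≤ gam F n))
    (fun _ h => Subgroup.mem_subgroupOf.2 (Subgroup.mem_subgroupOf.1 h).2)

/-- The group `M` is free abelian, freely generated (without repetitions) by the family `v`. -/
def FreelyGeneratesAb {ι M : Type*} [Group M] (v : ι → M) : Prop :=
  ∃ φ : M ≃* Multiplicative (ι →₀ ℤ), ∀ i, φ (v i) = Multiplicative.ofAdd (Finsupp.single i 1)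

/-- The output of one diagonalisation: a finite family of generators, split into the part `y`
which is nontrivial modulo the next term of the lower central series and the part `z` which
is trivial there. -/
structure RelStage (F : Type*) where
  s : ℕ
  t : ℕ
  y : Fin s → F
  z : Fin t → F

/-- All generators in a stage, `y` and `z` together. -/
def RelStage.gens {F : Type*} (S : RelStage F) : Fin S.s ⊕ Fin S.t → F := Sum.elim S.y S.z

/-- The diagonal form in weight `n` with respect to `x_1, …, x_m`: `s ≤ m`,
`y_i ≡ x_i ^ d_i` and `z_i ≡ 1` modulo `γ_{n+1} F`, with `0 < d_i` and `d_1 ∣ d_2 ∣ ⋯ ∣ d_s`. -/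
def RelStage.IsDiagonal {F : Type*} [Group F] (n : ℕ) {m : ℕ} (x : Fin m → F)
    (S : RelStage F) : Prop :=
  ∃ (h : S.s ≤ m) (d : Fin S.s → ℕ),
    (∀ i, 0 < d i) ∧ (∀ i j, i ≤ j → d i ∣ d j) ∧
    (∀ i, (S.y i)⁻¹ * x (Fin.castLE h i) ^ d i ∈ gam F (n + 1)) ∧
    (∀ i, S.z i ∈ gam F (n + 1))

/-- The first stage: `y, z` are free generators of the subgroup `H_1` generated by `A`, in
diagonal form with respect to the free generators `x` of `F`. -/
def RelStage.IsFirst {F : Type*} [Group F] (A : Set F) {m : ℕ} (x : FreeGroupBasis (Fin m) F)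
    (S : RelStage F) : Prop :=
  (∃ B : FreeGroupBasis (Fin S.s ⊕ Fin S.t) (Subgroup.closure A), ∀ k, (B k : F) = S.gens k) ∧
  S.IsDiagonal 1 (fun j => x j)

/-- The subgroup `H_{n+1}` built from stage `n`: it is generated by the trivial part `z` and by
all the commutators `[y_i, x_j]`. -/
def RelStage.nextSubgroup {F : Type*} [Group F] {m : ℕ} (x : FreeGroupBasis (Fin m) F)
    (S : RelStage F) : Subgroup F :=
  Subgroup.closure (Set.range S.z ∪ {g | ∃ i j, g = leftComm (S.y i) (x j)})

/-- `S'` is a stage of weight `n + 1` following the stage `S` of weight `n`: its members generate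
`H_{n+1}` and are in diagonal form with respect to some family freely generating the free
abelian group `γ_{n+1} F / γ_{n+2} F`. -/
def RelStage.IsNext {F : Type*} [Group F] {m : ℕ} (x : FreeGroupBasis (Fin m) F) (n : ℕ)
    (S S' : RelStage F) : Prop :=
  Subgroup.closure (Set.range S'.gens) = S.nextSubgroup x ∧
  ∃ (m' : ℕ) (x' : Fin m' → gam F (n + 1)),
    FreelyGeneratesAb (fun j => (x' j : LowerCentralFactor F (n + 1))) ∧
    S'.IsDiagonal (n + 1) (fun j => (x' j : F))

/-- `IsRelStage A x n S`: the iterated construction, started from the normal generators `A` and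
the free generators `x`, can reach `S` in weight `n`. The family `S.y` is then the set `R_n`
of `R`-basic commutators of weight `n`, where `R` is the normal closure of `A`. -/
inductive IsRelStage {F : Type*} [Group F] (A : Set F) {m : ℕ} (x : FreeGroupBasis (Fin m) F) :
    ℕ → RelStage F → Prop
  | first {S : RelStage F} : S.IsFirst A x → IsRelStage A x 1 S
  | next {n : ℕ} {S S' : RelStage F} :
      IsRelStage A x n S → S.IsNext x n S' → IsRelStage A x (n + 1) S'

open scoped commutatorElement

/-! The heart is an invariant of the stages: the normal closure of the `y_i` and `z_i` of weight `n`
is `R ∩ γ_n F`, the `z_i` lie in `γ_{n+1} F`, and the `y_i` are independent modulo `γ_{n+1} F`. To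
pass to weight `n + 1`, let `N` be the normal closure of `H_{n+1}`. Modulo `N` the `z_i` vanish and
the `y_i` are central, because `N` contains every `[y_i, x_j]`. So each element of `R ∩ γ_n F` is a
product `∏ y_i ^ c_i` modulo `N`, and with the same exponents modulo `γ_{n+1} F`. If the element
lies in `γ_{n+1} F`, independence gives `c = 0`, so it lies in `N`; hence `N = R ∩ γ_{n+1} F`. The
same expression shows that the `y_i` generate the relative factor. This is
`RelStage.exists_prod_of_mem_normalClosure` and `IsRelStage.invariant`.

The choices exist by Smith normal form (`ElementaryClosed.exists_diagonal`), with row and column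
operations realised by Nielsen transformations of the two tuples. In weight 1, `H_1` is free by
Nielsen–Schreier. In higher weight one needs `γ_n F / γ_{n+1} F` to be free abelian of finite rank
(`FreeGroupBasis.exists_freelyGeneratesAb`): commutators along standard bracketings of Lyndon words
span it by a Jacobi rewriting, and are independent because their leading Magnus coefficients are
unitriangular.

The quotient statement is the first isomorphism theorem for `γ_i F → γ_i G / γ_{i+1} G`. -/

/-! ### Freely generated abelian groups -/

/-- Commutativity of `M` is inherited along `f`, so that `RelFactor` needs no abelian structure of
its own and independence can be tested in the lower central factor of `F`. -/
theorem FreelyGeneratesAb.of_injective {ι M V : Type*} [Fintype ι] [Group M] [CommGroup V]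
    (f : M →* V) (hf : Function.Injective f) (v : ι → M)
    (hgen : Subgroup.closure (Set.range v) = ⊤)
    (hind : ∀ c : ι → ℤ, ∏ i, f (v i) ^ c i = 1 → c = 0) : FreelyGeneratesAb v := by
  classical
  let _ : CommGroup M :=
    { (inferInstance : Group M) with
      mul_comm := fun a b => hf (by rw [map_mul, map_mul, mul_comm]) }
  have hli : LinearIndependent ℤ (fun i => Additive.ofMul (v i)) := by
    rw [Fintype.linearIndependent_iff]
    intro c hc
    have h1 : ∏ i, v i ^ c i = 1 := by
      apply Additive.ofMul.injective
      rw [ofMul_prod]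
      simpa using hc
    have := hind c (by simpa using congrArg f h1)
    intro i
    rw [this]
    rfl
  have hsp : ⊤ ≤ Submodule.span ℤ (Set.range (fun i => Additive.ofMul (v i))) := by
    intro a _
    have ha : a.toMul ∈ Subgroup.closure (Set.range v) := hgen ▸ Subgroup.mem_top _
    have : ∀ g ∈ Subgroup.closure (Set.range v), Additive.ofMul g ∈
        Submodule.span ℤ (Set.range (fun i => Additive.ofMul (v i))) := by
      intro g hg
      induction hg using Subgroup.closure_induction with
      | mem g hg =>
        obtain ⟨i, rfl⟩ := hg
        exact Submodule.subset_span ⟨i, rfl⟩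
      | one => exact Submodule.zero_mem _
      | mul g h _ _ h1 h2 => exact Submodule.add_mem _ h1 h2
      | inv g _ h1 => exact Submodule.neg_mem _ h1
    exact this _ ha
  let B := Module.Basis.mk hli hsp
  refine ⟨AddEquiv.toMultiplicativeRight B.repr.toAddEquiv, fun i => ?_⟩
  have : B i = Additive.ofMul (v i) := by simp [B]
  change Multiplicative.ofAdd (B.repr (Additive.ofMul (v i))) = _
  rw [← this, B.repr_self]

theorem FreelyGeneratesAb.eq_zero_of_prod_eq_one {ι κ V : Type*} [Fintype κ] [CommGroup V]
    {v : ι → V} (hv : FreelyGeneratesAb v) {f : κ → ι} (hf : Function.Injective f) (c : κ → ℤ)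
    (hc : ∏ i, v (f i) ^ c i = 1) : c = 0 := by
  classical
  obtain ⟨φ, hφ⟩ := hv
  have h := congrArg (fun a => (φ a).toAdd) hc
  simp only [map_prod, map_zpow, hφ, map_one, toAdd_one, toAdd_prod, toAdd_zpow, toAdd_ofAdd] at h
  funext i
  have h2 := DFunLike.congr_fun h (f i)
  simpa [Finsupp.finsetSum_apply, Finsupp.single_apply, hf.eq_iff] using h2

theorem FreelyGeneratesAb.closure_eq_top {ι V : Type*} [Group V]
    {v : ι → V} (hv : FreelyGeneratesAb v) : Subgroup.closure (Set.range v) = ⊤ := by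
  classical
  obtain ⟨φ, hφ⟩ := hv
  rw [eq_top_iff]
  intro g _
  have key : ∀ f : ι →₀ ℤ, φ.symm (Multiplicative.ofAdd f) ∈ Subgroup.closure (Set.range v) := by
    intro f
    induction f using Finsupp.induction_linear with
    | zero => exact (map_one φ.symm).symm ▸ one_mem _
    | add f g hf hg =>
      rw [ofAdd_add, map_mul]
      exact mul_mem hf hg
    | single i k =>
      have : Multiplicative.ofAdd (Finsupp.single i k) =
          φ (v i ^ k) := by
        rw [map_zpow, hφ, ← ofAdd_zsmul, Finsupp.smul_single, smul_eq_mul, mul_one]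
      rw [this, MulEquiv.symm_apply_apply]
      exact Subgroup.zpow_mem _ (Subgroup.subset_closure (Set.mem_range_self i)) k
  simpa using key (φ g).toAdd

theorem FreelyGeneratesAb.reindex {ι κ V : Type*} [Group V] {v : ι → V}
    (hv : FreelyGeneratesAb v) (σ : κ ≃ ι) : FreelyGeneratesAb (fun i => v (σ i)) := by
  obtain ⟨φ, hφ⟩ := hv
  refine ⟨φ.trans (AddEquiv.toMultiplicative (Finsupp.domCongr σ.symm)), fun i => ?_⟩
  change Multiplicative.ofAdd (Finsupp.domCongr σ.symm (φ (v (σ i))).toAdd) = _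
  rw [hφ]
  simp [Finsupp.domCongr]

/-! ### Lower central series and quotients -/

theorem gam_succ (G : Type*) [Group G] {n : ℕ} (hn : 1 ≤ n) : gam G (n + 1) = ⁅gam G n, ⊤⁆ := by
  obtain ⟨k, rfl⟩ := Nat.exists_eq_add_of_le' hn
  rfl

theorem gam_one (G : Type*) [Group G] : gam G 1 = ⊤ := rfl

theorem gam_antitone (G : Type*) [Group G] : Antitone (gam G) := fun _ _ h =>
  Subgroup.lowerCentralSeries_antitone _ (Nat.sub_le_sub_right h 1)

theorem gam_succ_le (G : Type*) [Group G] (n : ℕ) : gam G (n + 1) ≤ gam G n :=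
  gam_antitone G n.le_succ

theorem commutator_mem_gam_succ {G : Type*} [Group G] {n : ℕ} {a : G} (ha : a ∈ gam G n) (b : G) :
    ⁅a, b⁆ ∈ gam G (n + 1) := by
  rcases n with _ | n
  · exact Subgroup.mem_top _
  · exact Subgroup.commutator_mem_commutator ha (Subgroup.mem_top b)

theorem commutator_mem_gam_succ' {G : Type*} [Group G] {n : ℕ} {a : G} (ha : a ∈ gam G n) (b : G) :
    ⁅b, a⁆ ∈ gam G (n + 1) := by
  rw [← commutatorElement_inv]
  exact inv_mem (commutator_mem_gam_succ ha b)

theorem map_gam {G H : Type*} [Group G] [Group H] (f : G →* H) (hf : Function.Surjective f)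
    (n : ℕ) : (gam G n).map f = gam H n := by
  rw [Subgroup.map_lowerCentralSeries, Subgroup.map_top_of_surjective f hf]

theorem relFactorIncl_injective {F : Type*} [Group F] (R : Subgroup F) [R.Normal] (n : ℕ) :
    Function.Injective (relFactorIncl R n) := by
  rw [injective_iff_map_eq_one]
  intro a
  obtain ⟨a, rfl⟩ := QuotientGroup.mk_surjective a
  intro h
  change ((Subgroup.inclusion (inf_le_right : R ⊓ gam F n ≤ gam F n) a : gam F n) :
    LowerCentralFactor F n) = 1 at h
  rw [QuotientGroup.eq_one_iff, Subgroup.mem_subgroupOf] at h ⊢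
  exact ⟨a.2.1, h⟩

/-- Surjections carry `γ_n` onto `γ_n`, so `γ_i F` maps onto the factor of `G`; the kernel consists
of the elements congruent modulo `γ_{i+1} F` to elements of `R ∩ γ_i F`. -/
theorem exists_factor_mulEquiv {F G : Type*} [Group F] [Group G] (R : Subgroup F) [R.Normal]
    (e : G ≃* F ⧸ R) (i : ℕ) :
    ∃ φ : (LowerCentralFactor F i ⧸ (relFactorIncl R i).range) ≃* LowerCentralFactor G i,
      ∀ (f : gam F i) (g : gam G i), e (g : G) = ((f : F) : F ⧸ R) →
        φ (((f : LowerCentralFactor F i)) : LowerCentralFactor F i ⧸ (relFactorIncl R i).range)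
          = (g : LowerCentralFactor G i) := by
  let π : F →* G := e.symm.toMonoidHom.comp (QuotientGroup.mk' R)
  have hπ : Function.Surjective π :=
    e.symm.surjective.comp (QuotientGroup.mk'_surjective R)
  have hker : ∀ a, π a = 1 ↔ a ∈ R := by
    intro a
    change e.symm (a : F ⧸ R) = 1 ↔ _
    rw [map_eq_one_iff _ e.symm.injective, QuotientGroup.eq_one_iff]
  have hmem : ∀ n, ∀ a ∈ gam F n, π a ∈ gam G n := fun n a ha =>
    map_gam π hπ n ▸ Subgroup.mem_map_of_mem π ha
  let ψ : gam F i →* gam G i :=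
    (π.comp (gam F i).subtype).codRestrict (gam G i) (fun a => hmem i a a.2)
  let Ψ : LowerCentralFactor F i →* LowerCentralFactor G i :=
    QuotientGroup.map _ _ ψ (fun a ha => by
      rw [Subgroup.mem_subgroupOf] at ha
      exact Subgroup.mem_subgroupOf.2 (hmem _ _ ha))
  have hΨ : ∀ f : gam F i, Ψ (f : LowerCentralFactor F i) = (ψ f : LowerCentralFactor G i) :=
    fun f => rfl
  have hsurj : Function.Surjective Ψ := by
    intro g
    obtain ⟨g, rfl⟩ := QuotientGroup.mk_surjective g
    have : (g : G) ∈ (gam F i).map π := by rw [map_gam π hπ]; exact g.2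
    obtain ⟨f, hf, hfg⟩ := this
    refine ⟨((⟨f, hf⟩ : gam F i) : LowerCentralFactor F i), ?_⟩
    rw [hΨ]
    congr 1
    exact Subtype.ext hfg
  have hkerΨ : Ψ.ker = (relFactorIncl R i).range := by
    ext a
    obtain ⟨a, rfl⟩ := QuotientGroup.mk_surjective a
    rw [MonoidHom.mem_ker, MonoidHom.mem_range]
    constructor
    · intro h
      rw [hΨ, QuotientGroup.eq_one_iff, Subgroup.mem_subgroupOf] at h
      have h' : π a ∈ gam G (i + 1) := h
      -- Lifting `π a` to some `c ∈ γ_{i+1} F` gives `a c⁻¹ ∈ R ∩ γ_i F`, in the same class as `a`.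
      rw [← map_gam π hπ] at h'
      obtain ⟨c, hc, hca⟩ := h'
      have hr : (a : F) * c⁻¹ ∈ R := by
        rw [← hker, map_mul, map_inv, hca, mul_inv_cancel]
      have hc' := gam_succ_le F i hc
      refine ⟨((⟨a * c⁻¹, hr, (gam F i).mul_mem a.2 ((gam F i).inv_mem hc')⟩ : (R ⊓ gam F i : Subgroup F)) :
        RelFactor R i), ?_⟩
      change ((⟨a * c⁻¹, _⟩ : gam F i) : LowerCentralFactor F i) = _
      rw [QuotientGroup.eq, Subgroup.mem_subgroupOf]
      change ((a : F) * c⁻¹)⁻¹ * a ∈ _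
      simpa [mul_assoc] using hc
    · rintro ⟨b, hb⟩
      obtain ⟨b, rfl⟩ := QuotientGroup.mk_surjective b
      rw [← hb]
      change Ψ ((Subgroup.inclusion (inf_le_right : R ⊓ gam F i ≤ gam F i) b : gam F i) :
        LowerCentralFactor F i) = 1
      rw [hΨ]
      have : ψ (Subgroup.inclusion (inf_le_right : R ⊓ gam F i ≤ gam F i) b) = 1 :=
        Subtype.ext ((hker _).2 b.2.1)
      rw [this]
      rfl
  refine ⟨(QuotientGroup.quotientMulEquivOfEq hkerΨ.symm).trans
    (QuotientGroup.quotientKerEquivOfSurjective Ψ hsurj), fun f g hfg => ?_⟩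
  change Ψ (f : LowerCentralFactor F i) = _
  rw [hΨ]
  congr 1
  refine Subtype.ext ?_
  change e.symm ((f : F) : F ⧸ R) = g
  rw [← hfg, MulEquiv.symm_apply_apply]

/-! ### Weight one and independence of diagonal families -/

theorem FreeGroupBasis.closure_range {ι F : Type*} [Group F] (x : FreeGroupBasis ι F) :
    Subgroup.closure (Set.range x) = ⊤ := by
  have h : Set.range x = x.repr.symm '' Set.range (FreeGroup.of : ι → FreeGroup ι) := by
    rw [← Set.range_comp]
    rfl
  have h2 := MonoidHom.map_closure x.repr.symm.toMonoidHom
    (Set.range (FreeGroup.of : ι → FreeGroup ι))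
  rw [FreeGroup.closure_range_of,
    Subgroup.map_top_of_surjective _ x.repr.symm.surjective] at h2
  rw [h]
  exact h2.symm

theorem map_eq_one_of_mem_gam_two {F V : Type*} [Group F] [CommGroup V] (f : F →* V) {g : F}
    (hg : g ∈ gam F 2) : f g = 1 :=
  Abelianization.commutator_subset_ker f hg

/-- Independence is detected by the homomorphisms to `ℤ` taking one basis element to 1 and the
others to 0. -/
theorem FreeGroupBasis.freelyGeneratesAb {ι F : Type*} [Fintype ι] [Group F]
    (x : FreeGroupBasis ι F) :
    FreelyGeneratesAb (fun i => ((⟨x i, Subgroup.mem_top _⟩ : gam F 1) :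
      LowerCentralFactor F 1)) := by
  classical
  refine FreelyGeneratesAb.of_injective (MonoidHom.id _) Function.injective_id _ ?_ ?_
  · rw [eq_top_iff]
    intro a _
    obtain ⟨⟨a, ha⟩, rfl⟩ := QuotientGroup.mk_surjective a
    let f : F →* LowerCentralFactor F 1 :=
      (QuotientGroup.mk' _).comp ((MonoidHom.id F).codRestrict (gam F 1)
        (fun a => Subgroup.mem_top a))
    have h1 : f a ∈ (Subgroup.closure (Set.range x)).map f :=
      Subgroup.mem_map_of_mem f (x.closure_range ▸ Subgroup.mem_top a)
    rw [MonoidHom.map_closure, ← Set.range_comp] at h1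
    exact h1
  · intro c hc
    funext i
    let f : F →* Multiplicative ℤ := x.lift (fun j => Multiplicative.ofAdd (if j = i then 1 else 0))
    let Φ : LowerCentralFactor F 1 →* Multiplicative ℤ :=
      QuotientGroup.lift _ (f.comp (gam F 1).subtype) (fun a ha =>
        map_eq_one_of_mem_gam_two f (Subgroup.mem_subgroupOf.1 ha))
    have hΦ : ∀ j, Φ ((⟨x j, Subgroup.mem_top _⟩ : gam F 1) : LowerCentralFactor F 1) =
        Multiplicative.ofAdd (if j = i then 1 else 0) := fun j =>
      congrFun (x.lift.symm_apply_apply _) j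
    have h2 := congrArg (fun a => (Φ a).toAdd) hc
    simpa only [Pi.zero_apply, MonoidHom.id_apply, map_prod, map_zpow, hΦ, map_one, toAdd_one, toAdd_prod,
      toAdd_zpow, toAdd_ofAdd, smul_eq_mul, mul_ite, mul_one, mul_zero, Finset.sum_ite_eq',
      Finset.mem_univ, if_true] using h2

/-- Distinct `y_i` are positive powers of distinct members of a free family, which leaves no
relation. -/
theorem RelStage.IsDiagonal.independent {F : Type*} [Group F] {n m : ℕ} {x : Fin m → gam F n}
    {S : RelStage F} (hS : S.IsDiagonal n (fun j => (x j : F)))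
    (hx : FreelyGeneratesAb (fun j => (x j : LowerCentralFactor F n))) :
    ∃ hy : ∀ i, S.y i ∈ gam F n, ∀ c : Fin S.s → ℤ,
      ∏ i, ((⟨S.y i, hy i⟩ : gam F n) : LowerCentralFactor F n) ^ c i = 1 → c = 0 := by
  obtain ⟨h, d, hd, -, hy, -⟩ := hS
  have hmem : ∀ i, S.y i ∈ gam F n := fun i => by
    have h1 := (gam F n).mul_mem ((gam F n).pow_mem (x (Fin.castLE h i)).2 (d i))
      ((gam F n).inv_mem (gam_succ_le F n (hy i)))
    simpa using h1
  refine ⟨hmem, fun c hc => ?_⟩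
  have hcl : ∀ i, ((⟨S.y i, hmem i⟩ : gam F n) : LowerCentralFactor F n) =
      (x (Fin.castLE h i) : LowerCentralFactor F n) ^ d i := fun i => by
    rw [← QuotientGroup.mk_pow, QuotientGroup.eq, Subgroup.mem_subgroupOf]
    exact hy i
  simp only [hcl, ← zpow_natCast, ← zpow_mul] at hc
  have h0 := hx.eq_zero_of_prod_eq_one (Fin.castLE_injective h) _ hc
  funext i
  have h1 := congrFun h0 i
  simpa [(hd i).ne'] using h1

/-! ### The invariant of the stages -/

theorem leftComm_eq {G : Type*} [Group G] (a b : G) : leftComm a b = ⁅a⁻¹, b⁻¹⁆ := by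
  simp [leftComm, commutatorElement_def]

/-- An element of the normal closure of a stage is congruent to a product of powers of the `y_i`,
both modulo the next term of the lower central series and modulo the normal closure of the next
stage. -/
theorem RelStage.exists_prod_of_mem_normalClosure {F : Type*} [Group F] {m : ℕ}
    (x : FreeGroupBasis (Fin m) F) {n : ℕ} {S : RelStage F} (hy : ∀ i, S.y i ∈ gam F n)
    (hz : ∀ i, S.z i ∈ gam F (n + 1)) {g : F}
    (hg : g ∈ Subgroup.normalClosure (Set.range S.gens)) :
    ∃ (hgn : g ∈ gam F n) (c : Fin S.s → ℤ),
      ((⟨g, hgn⟩ : gam F n) : LowerCentralFactor F n) =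
        ∏ i, ((⟨S.y i, hy i⟩ : gam F n) : LowerCentralFactor F n) ^ c i ∧
      (c = 0 → g ∈ Subgroup.normalClosure (S.nextSubgroup x : Set F)) := by
  set N := Subgroup.normalClosure (S.nextSubgroup x : Set F) with hN
  have hsub : ∀ a ∈ S.nextSubgroup x, a ∈ N := fun a ha => Subgroup.subset_normalClosure ha
  -- Commuting with the generators `x_j` modulo `N` is enough for centrality.
  have hyc : ∀ i, ((S.y i : F) : F ⧸ N) ∈ Subgroup.center (F ⧸ N) := by
    intro i
    rw [Subgroup.mem_center_iff]
    intro q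
    obtain ⟨q, rfl⟩ := QuotientGroup.mk_surjective q
    have hq : q ∈ (Subgroup.centralizer {((S.y i : F) : F ⧸ N)}).comap (QuotientGroup.mk' N) := by
      have : Subgroup.closure (Set.range x) ≤
          (Subgroup.centralizer {((S.y i : F) : F ⧸ N)}).comap (QuotientGroup.mk' N) := by
        rw [Subgroup.closure_le]
        rintro _ ⟨j, rfl⟩
        change ((x j : F) : F ⧸ N) ∈ Subgroup.centralizer {((S.y i : F) : F ⧸ N)}
        rw [Subgroup.mem_centralizer_singleton_iff, ← QuotientGroup.mk_mul, ← QuotientGroup.mk_mul,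
          QuotientGroup.eq]
        have h1 : leftComm (S.y i) (x j) ∈ N :=
          hsub _ (Subgroup.subset_closure (Or.inr ⟨i, j, rfl⟩))
        simpa [leftComm, mul_assoc] using h1
      exact this (x.closure_range ▸ Subgroup.mem_top q)
    exact (Subgroup.mem_centralizer_singleton_iff.1 hq)
  let _ : CommGroup (Subgroup.center (F ⧸ N)) :=
    { (inferInstance : Group (Subgroup.center (F ⧸ N))) with
      mul_comm := fun a b => Subtype.ext (Subgroup.mem_center_iff.1 b.2 a) }
  let y' : Fin S.s → Subgroup.center (F ⧸ N) := fun i => ⟨_, hyc i⟩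
  -- Both congruences must hold with the same exponents `c`, so they are carried together; `T` is
  -- normal and contains the generators of the stage.
  let T : Subgroup F :=
    { carrier := {g | ∃ (hgn : g ∈ gam F n) (c : Fin S.s → ℤ),
        ((⟨g, hgn⟩ : gam F n) : LowerCentralFactor F n) =
          ∏ i, ((⟨S.y i, hy i⟩ : gam F n) : LowerCentralFactor F n) ^ c i ∧
        ((g : F) : F ⧸ N) = ((∏ i, y' i ^ c i : Subgroup.center (F ⧸ N)) : F ⧸ N)}
      one_mem' := by
        refine ⟨one_mem _, 0, ?_, ?_⟩
        · simp only [Pi.zero_apply, zpow_zero, Finset.prod_const_one]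
          rfl
        · simp
      mul_mem' := by
        rintro a b ⟨ha, c, h1, h2⟩ ⟨hb, c', h1', h2'⟩
        refine ⟨mul_mem ha hb, c + c', ?_, ?_⟩
        · simp only [Pi.add_apply, zpow_add, Finset.prod_mul_distrib, ← h1, ← h1']
          rfl
        · simp only [Pi.add_apply, zpow_add, Finset.prod_mul_distrib, Subgroup.coe_mul, ← h2,
            ← h2', QuotientGroup.mk_mul]
      inv_mem' := by
        rintro a ⟨ha, c, h1, h2⟩
        refine ⟨inv_mem ha, -c, ?_, ?_⟩
        · simp only [Pi.neg_apply, zpow_neg, Finset.prod_inv_distrib, ← h1]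
          rfl
        · simp only [Pi.neg_apply, zpow_neg, Finset.prod_inv_distrib, Subgroup.coe_inv, ← h2,
            QuotientGroup.mk_inv] }
  have hT : T.Normal := by
    refine ⟨?_⟩
    rintro a ⟨ha, c, h1, h2⟩ g
    refine ⟨Subgroup.Normal.conj_mem inferInstance _ ha g, c, ?_, ?_⟩
    · rw [← h1, QuotientGroup.eq, Subgroup.mem_subgroupOf]
      have h3 := commutator_mem_gam_succ ((gam F n).inv_mem ha) g
      have h4 := commutator_mem_gam_succ' ha g
      have h5 := (gam F (n + 1)).inv_mem
        (Subgroup.Normal.conj_mem (inferInstance : (gam F (n + 1)).Normal) _ h4 a⁻¹)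
      simpa [commutatorElement_def, mul_assoc] using h5
    · have hc := (∏ i, y' i ^ c i : Subgroup.center (F ⧸ N)).2
      rw [Subgroup.mem_center_iff] at hc
      rw [QuotientGroup.mk_mul, QuotientGroup.mk_mul, h2, hc, QuotientGroup.mk_inv,
        mul_inv_cancel_right]
  have hle : Subgroup.normalClosure (Set.range S.gens) ≤ T := by
    refine Subgroup.normalClosure_le_normal ?_
    rintro _ ⟨i | i, rfl⟩
    · refine ⟨hy i, Pi.single i 1, ?_, ?_⟩
      · simp [Pi.single_apply, RelStage.gens]
      · simp [Pi.single_apply, RelStage.gens, y']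
    · refine ⟨gam_succ_le F n (hz i), 0, ?_, ?_⟩
      · simp only [Pi.zero_apply, zpow_zero, Finset.prod_const_one]
        rw [QuotientGroup.eq_one_iff, Subgroup.mem_subgroupOf]
        exact hz i
      · simp only [Pi.zero_apply, zpow_zero, Finset.prod_const_one, Subgroup.coe_one]
        rw [QuotientGroup.eq_one_iff]
        exact hsub _ (Subgroup.subset_closure (Or.inl ⟨i, rfl⟩))
  obtain ⟨hgn, c, h1, h2⟩ := hle hg
  refine ⟨hgn, c, h1, ?_⟩
  rintro rfl
  rw [← QuotientGroup.eq_one_iff, h2]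
  simp

/-- For `≥`, an element of `γ_{n+1} F` has trivial class, so independence kills its exponents and it
falls into the normal closure of `H_{n+1}`. -/
theorem RelStage.normalClosure_nextSubgroup {F : Type*} [Group F] {m : ℕ}
    (x : FreeGroupBasis (Fin m) F) {n : ℕ} {S : RelStage F} (hy : ∀ i, S.y i ∈ gam F n)
    (hind : ∀ c : Fin S.s → ℤ,
      ∏ i, ((⟨S.y i, hy i⟩ : gam F n) : LowerCentralFactor F n) ^ c i = 1 → c = 0)
    (hz : ∀ i, S.z i ∈ gam F (n + 1)) :
    Subgroup.normalClosure (S.nextSubgroup x : Set F) =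
      Subgroup.normalClosure (Set.range S.gens) ⊓ gam F (n + 1) := by
  apply le_antisymm
  · refine Subgroup.normalClosure_le_normal ?_
    change S.nextSubgroup x ≤ _
    rw [RelStage.nextSubgroup, Subgroup.closure_le]
    rintro g (⟨i, rfl⟩ | ⟨i, j, rfl⟩)
    · exact ⟨Subgroup.subset_normalClosure ⟨Sum.inr i, rfl⟩, hz i⟩
    · rw [leftComm_eq]
      refine ⟨?_, commutator_mem_gam_succ (inv_mem (hy i)) _⟩
      have h1 : (S.y i)⁻¹ ∈ Subgroup.normalClosure (Set.range S.gens) :=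
        inv_mem (Subgroup.subset_normalClosure ⟨Sum.inl i, rfl⟩)
      rw [SetLike.mem_coe, commutatorElement_def, mul_assoc, mul_assoc]
      refine mul_mem h1 ?_
      rw [← mul_assoc]
      exact Subgroup.Normal.conj_mem inferInstance _ (inv_mem h1) _
  · rintro g ⟨hg, hg'⟩
    obtain ⟨hgn, c, h1, h2⟩ := S.exists_prod_of_mem_normalClosure x hy hz hg
    refine h2 (hind c ?_)
    rw [← h1, QuotientGroup.eq_one_iff, Subgroup.mem_subgroupOf]
    exact hg'

/-- The induction needs all clauses at once: the normal closure in weight `n + 1` uses independence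
and the position of `z` in weight `n`, while the last two clauses are renewed by each diagonal form.
-/
theorem IsRelStage.invariant {F : Type*} [Group F] {A : Set F} {R : Subgroup F}
    (hR : Subgroup.normalClosure A = R) {m : ℕ} {x : FreeGroupBasis (Fin m) F} {n : ℕ}
    {S : RelStage F} (hS : IsRelStage A x n S) :
    1 ≤ n ∧ Subgroup.normalClosure (Set.range S.gens) = R ⊓ gam F n ∧
      (∀ i, S.z i ∈ gam F (n + 1)) ∧ ∃ hy : ∀ i, S.y i ∈ gam F n, ∀ c : Fin S.s → ℤ,
        ∏ i, ((⟨S.y i, hy i⟩ : gam F n) : LowerCentralFactor F n) ^ c i = 1 → c = 0 := by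
  induction hS with
  | @first S h =>
    obtain ⟨⟨B, hB⟩, hd⟩ := h
    refine ⟨le_rfl, ?_, ?_, RelStage.IsDiagonal.independent
      (x := fun j => ⟨x j, Subgroup.mem_top _⟩) hd x.freelyGeneratesAb⟩
    · have h1 : Subgroup.closure (Set.range S.gens) = Subgroup.closure A := by
        have h2 := congrArg (Subgroup.map (Subgroup.closure A).subtype) B.closure_range
        rw [MonoidHom.map_closure, ← Set.range_comp, ← MonoidHom.range_eq_map,
          Subgroup.range_subtype] at h2
        rw [← h2]
        congr 2
        funext k
        exact (hB k).symm
      rw [← Subgroup.normalClosure_closure_eq_normalClosure, h1,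
        Subgroup.normalClosure_closure_eq_normalClosure, hR, gam_one, inf_top_eq]
    · obtain ⟨_, _, _, _, _, hz⟩ := hd
      exact hz
  | @next n S S' _ h ih =>
    obtain ⟨hn, hcl, hz, hy, hind⟩ := ih
    obtain ⟨hgen, m', x', hx', hd⟩ := h
    refine ⟨by omega, ?_, ?_, hd.independent hx'⟩
    · rw [← Subgroup.normalClosure_closure_eq_normalClosure, hgen,
        S.normalClosure_nextSubgroup x hy hind hz, hcl, inf_assoc,
        inf_eq_right.2 (gam_succ_le F n)]
    · obtain ⟨_, _, _, _, _, hz'⟩ := hd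
      exact hz'

theorem IsRelStage.freelyGeneratesAb {F : Type*} [Group F] {A : Set F} {R : Subgroup F} [R.Normal]
    (hR : Subgroup.normalClosure A = R) {m : ℕ} {x : FreeGroupBasis (Fin m) F} {n : ℕ}
    {S : RelStage F} (hS : IsRelStage A x n S) :
    ∃ hy : ∀ j, S.y j ∈ R ⊓ gam F n, FreelyGeneratesAb
      (fun j => ((⟨S.y j, hy j⟩ : (R ⊓ gam F n : Subgroup F)) : RelFactor R n)) := by
  obtain ⟨-, hcl, hz, hy, hind⟩ := hS.invariant hR
  have hmem : ∀ j, S.y j ∈ R ⊓ gam F n := fun j =>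
    hcl.le (Subgroup.subset_normalClosure ⟨Sum.inl j, rfl⟩)
  refine ⟨hmem, FreelyGeneratesAb.of_injective (relFactorIncl R n) (relFactorIncl_injective R n)
    _ ?_ hind⟩
  rw [eq_top_iff]
  intro a _
  obtain ⟨a, rfl⟩ := QuotientGroup.mk_surjective a
  have ha : (a : F) ∈ Subgroup.normalClosure (Set.range S.gens) := hcl.ge a.2
  obtain ⟨han, c, h1, -⟩ := S.exists_prod_of_mem_normalClosure x hy hz ha
  have h2 : relFactorIncl R n (a : RelFactor R n) ∈ (Subgroup.closure (Set.range
      (fun j => ((⟨S.y j, hmem j⟩ : (R ⊓ gam F n : Subgroup F)) : RelFactor R n)))).map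
      (relFactorIncl R n) := by
    change ((⟨a, han⟩ : gam F n) : LowerCentralFactor F n) ∈ _
    rw [h1, MonoidHom.map_closure, ← Set.range_comp]
    exact Subgroup.prod_mem _ fun i _ =>
      Subgroup.zpow_mem _ (Subgroup.subset_closure (Set.mem_range_self i)) (c i)
  obtain ⟨b, hb, hba⟩ := h2
  exact relFactorIncl_injective R n hba ▸ hb

/-! ### Lyndon words and standard bracketings -/

section Words

variable {α : Type*}

namespace FreeMagma

/-- The word spelled by the leaves of a tree. -/
def word : FreeMagma α → List α
  | of a => [a]
  | x * y => word x ++ word y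

@[simp] theorem word_of (a : α) : (of a).word = [a] := rfl

@[simp] theorem word_mul (x y : FreeMagma α) : (x * y).word = x.word ++ y.word := rfl

@[simp] theorem length_of (a : α) : (of a).length = 1 := rfl

@[simp] theorem length_mul (x y : FreeMagma α) : (x * y).length = x.length + y.length := rfl

theorem length_word (t : FreeMagma α) : t.word.length = t.length := by
  induction t with
  | ih1 a => rfl
  | ih2 x y hx hy => simp [hx, hy]

theorem word_ne_nil (t : FreeMagma α) : t.word ≠ [] := by
  rw [← List.length_pos_iff, length_word]
  exact t.length_pos

end FreeMagma

variable [LinearOrder α]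

theorem List.append_lt_append_left_of_lt (u : List α) {v w : List α} (h : v < w) :
    u ++ v < u ++ w :=
  List.Lex.append_left (· < ·) h u

theorem List.lt_append_of_ne_nil (u : List α) {v : List α} (hv : v ≠ []) : u < u ++ v := by
  obtain ⟨a, v, rfl⟩ := List.exists_cons_of_ne_nil hv
  simpa using List.append_lt_append_left_of_lt u (List.Lex.nil : ([] : List α) < a :: v)

theorem List.le_append_self (u v : List α) : u ≤ u ++ v := by
  rcases eq_or_ne v [] with rfl | hv
  · simp
  · exact (List.lt_append_of_ne_nil u hv).le

/-- A lexicographic comparison is decided either by one word ending or by a first differing letter;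
in the second case it survives arbitrary continuations. -/
theorem List.eq_append_or_append_lt_append {u v : List α} (h : u < v) :
    (∃ t, t ≠ [] ∧ v = u ++ t) ∨ ∀ s t, u ++ s < v ++ t := by
  have h' : List.Lex (· < ·) u v := h
  clear h
  induction h' with
  | @nil a l => exact Or.inl ⟨a :: l, by simp, rfl⟩
  | @cons a u v _ ih =>
    rcases ih with ⟨t, ht, rfl⟩ | ih
    · exact Or.inl ⟨t, ht, rfl⟩
    · exact Or.inr fun s t => List.Lex.cons (ih s t)
  | @rel a u b v h => exact Or.inr fun s t => List.Lex.rel h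

theorem List.append_lt_append_of_length_eq {u v : List α} (h : u < v) (hl : u.length = v.length)
    (s t : List α) : u ++ s < v ++ t := by
  rcases List.eq_append_or_append_lt_append h with ⟨r, hr, rfl⟩ | h
  · rw [List.length_append] at hl
    have := List.length_pos_iff.2 hr
    omega
  · exact h s t

/-- A word which is smaller than all its proper nonempty suffixes. -/
def IsLyndon (w : List α) : Prop :=
  ∀ u v, u ≠ [] → v ≠ [] → w = u ++ v → w < v

theorem IsLyndon.append_lt {u v : List α} (hv : IsLyndon v) (hu0 : u ≠ []) (h : u < v) :
    u ++ v < v := by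
  rcases List.eq_append_or_append_lt_append h with ⟨t, ht, hvt⟩ | h
  · have h1 := List.append_lt_append_left_of_lt u (hv u t hu0 ht hvt)
    rwa [← hvt] at h1
  · simpa using h v []

/-- A suffix starting inside `u` is `c ++ v` with `u < c`. Since `c` is shorter than `u`, the two
differ at a letter, and this decides the comparison. -/
theorem IsLyndon.append {u v : List α} (hu : IsLyndon u) (hv : IsLyndon v) (hu0 : u ≠ [])
    (h : u < v) : IsLyndon (u ++ v) := by
  have huv := hv.append_lt hu0 h
  intro p q hp hq hpq
  rcases List.append_eq_append_iff.1 hpq with ⟨a, rfl, rfl⟩ | ⟨c, rfl, rfl⟩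
  · rcases eq_or_ne a [] with rfl | ha
    · simpa using huv
    · exact huv.trans (hv a q ha hq rfl)
  · rcases eq_or_ne c [] with rfl | hc
    · simpa using huv
    · rcases List.eq_append_or_append_lt_append (hu p c hp hc rfl) with ⟨t, -, ht⟩ | h1
      · have := congrArg List.length ht
        simp only [List.length_append] at this
        have := List.length_pos_iff.2 hp
        omega
      · exact h1 v v

namespace FreeMagma

/-- The standard bracketings of Lyndon words. -/
inductive IsStd : FreeMagma α → Prop
  | of (a : α) : IsStd (of a)
  | of_mul (a : α) {y : FreeMagma α} : IsStd y → [a] < y.word → IsStd (FreeMagma.of a * y)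
  | mul_mul {x₁ x₂ y : FreeMagma α} : IsStd (x₁ * x₂) → IsStd y → (x₁ * x₂).word < y.word →
      y.word ≤ x₂.word → IsStd (x₁ * x₂ * y)

theorem IsStd.factors {x y : FreeMagma α} (h : IsStd (x * y)) :
    IsStd x ∧ IsStd y ∧ x.word < y.word := by
  generalize hz : x * y = z at h
  cases h with
  | of a => cases hz
  | of_mul a h1 h2 => cases hz; exact ⟨.of a, h1, h2⟩
  | mul_mul h1 h2 h3 h4 => cases hz; exact ⟨h1, h2, h3⟩

theorem IsStd.le_right_of_mul_mul {x₁ x₂ y : FreeMagma α} (h : IsStd (x₁ * x₂ * y)) :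
    IsStd (x₁ * x₂) ∧ IsStd y ∧ y.word ≤ x₂.word := by
  generalize hz : x₁ * x₂ * y = z at h
  cases h with
  | of a => cases hz
  | of_mul a h1 h2 => cases hz
  | mul_mul h1 h2 h3 h4 => cases hz; exact ⟨h1, h2, h4⟩

theorem IsStd.isLyndon {t : FreeMagma α} (h : IsStd t) : IsLyndon t.word := by
  induction t with
  | ih1 a =>
    intro u v hu hv huv
    have := congrArg List.length huv
    have h1 := List.length_pos_iff.2 hu
    have h2 := List.length_pos_iff.2 hv
    simp only [word_of, List.length_cons, List.length_nil, List.length_append] at this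
    omega
  | ih2 x y hx hy =>
    obtain ⟨h1, h2, h3⟩ := h.factors
    exact (hx h1).append (hy h2) x.word_ne_nil h3

/-- The right factor is the least proper suffix. A suffix `c ++ y.word` starting properly inside `x₁
* x₂` has `x₂.word ≤ c` by induction, and `y.word ≤ x₂.word` is part of being standard. -/
theorem IsStd.le_suffix {x y : FreeMagma α} (h : IsStd (x * y)) {p q : List α} (hp : p ≠ [])
    (hq : q ≠ []) (hpq : x.word ++ y.word = p ++ q) : y.word ≤ q := by
  induction x generalizing y p q with
  | ih1 a =>
    obtain ⟨_, h2, _⟩ := h.factors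
    rcases List.append_eq_append_iff.1 hpq with ⟨c, rfl, hc⟩ | ⟨c, hc, rfl⟩
    · rcases eq_or_ne c [] with rfl | hc0
      · exact hc.le
      · exact (h2.isLyndon c q hc0 hq hc).le
    · have := congrArg List.length hc
      have h1 := List.length_pos_iff.2 hp
      simp only [word_of, List.length_cons, List.length_nil, List.length_append] at this
      have : c = [] := List.length_eq_zero_iff.1 (by omega)
      subst this
      rfl
  | ih2 x₁ x₂ ih _ =>
    obtain ⟨h1, h2, h3⟩ := h.le_right_of_mul_mul
    rcases List.append_eq_append_iff.1 hpq with ⟨c, rfl, hc⟩ | ⟨c, hc, rfl⟩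
    · rcases eq_or_ne c [] with rfl | hc0
      · exact hc.le
      · exact (h2.isLyndon c q hc0 hq hc).le
    · rcases eq_or_ne c [] with rfl | hc0
      · rfl
      · exact (h3.trans (ih h1 hp hc0 hc)).trans (List.le_append_self _ _)

/-- The word determines its least proper suffix, hence both factors recursively. -/
theorem IsStd.word_injective {t t' : FreeMagma α} (h : IsStd t) (h' : IsStd t')
    (hw : t.word = t'.word) : t = t' := by
  induction t generalizing t' with
  | ih1 a =>
    cases t' using FreeMagma.recOnMul with
    | ih1 b => exact congrArg FreeMagma.of (by simpa using hw)
    | ih2 x y _ _ =>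
      have := congrArg List.length hw
      have h1 := x.length_pos
      have h2 := y.length_pos
      simp only [length_word, length_of, length_mul] at this
      omega
  | ih2 x y hx hy =>
    cases t' using FreeMagma.recOnMul with
    | ih1 b =>
      have := congrArg List.length hw
      have h1 := x.length_pos
      have h2 := y.length_pos
      simp only [length_word, length_of, length_mul] at this
      omega
    | ih2 x' y' _ _ =>
      obtain ⟨h1, h2, _⟩ := h.factors
      obtain ⟨h1', h2', _⟩ := h'.factors
      have hy' : y.word = y'.word := le_antisymm
        (h.le_suffix x'.word_ne_nil y'.word_ne_nil hw)
        (h'.le_suffix x.word_ne_nil y.word_ne_nil hw.symm)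
      rw [word_mul, word_mul, hy', List.append_left_inj] at hw
      rw [hx h1 h1' hw, hy h2 h2' hy']

theorem IsStd.word_mul_lt {x y : FreeMagma α} (hy : IsStd y) (h : x.word < y.word) :
    (x * y).word < y.word :=
  hy.isLyndon.append_lt x.word_ne_nil h

end FreeMagma

end Words

/-! ### Commutator calculus modulo the lower central series -/

section Commutators

variable {G : Type*} [Group G]

/-- The elements commuting with `h` modulo the normal subgroup `K`. -/
def Subgroup.centralizerMod (K : Subgroup G) [K.Normal] (h : G) : Subgroup G :=
  (Subgroup.centralizer {(h : G ⧸ K)}).comap (QuotientGroup.mk' K)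

theorem Subgroup.mem_centralizerMod {K : Subgroup G} [K.Normal] {g h : G} :
    g ∈ K.centralizerMod h ↔ ⁅g, h⁆ ∈ K := by
  rw [Subgroup.centralizerMod, Subgroup.mem_comap, Subgroup.mem_centralizer_singleton_iff,
    ← QuotientGroup.eq_one_iff, QuotientGroup.coe_mk', ← commutatorElement_eq_one_iff_mul_comm]
  rfl

theorem Subgroup.mem_centralizerMod_comm {K : Subgroup G} [K.Normal] {g h : G} :
    g ∈ K.centralizerMod h ↔ h ∈ K.centralizerMod g := by
  rw [mem_centralizerMod, mem_centralizerMod, ← commutatorElement_inv, inv_mem_iff]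

/-- Induction on `j` with the three subgroups lemma, applied modulo the normal subgroup `γ_{i+j+1}`.
-/
theorem commutator_gam_le (i j : ℕ) : ⁅gam G i, gam G j⁆ ≤ gam G (i + j) := by
  induction j generalizing i with
  | zero =>
    exact Subgroup.commutator_le_left _ _
  | succ j ih =>
    rcases Nat.eq_zero_or_pos j with rfl | hj
    · rw [Subgroup.commutator_le]
      exact fun a ha b _ => commutator_mem_gam_succ ha b
    rw [gam_succ G hj, Subgroup.commutator_comm]
    have key : ∀ K : Subgroup G, K.Normal →
        ⁅⁅(⊤ : Subgroup G), gam G i⁆, gam G j⁆ ≤ K →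
        ⁅⁅gam G i, gam G j⁆, (⊤ : Subgroup G)⁆ ≤ K → ⁅⁅gam G j, (⊤ : Subgroup G)⁆, gam G i⁆ ≤ K := by
      intro K hK h1 h2
      have hb : ∀ H : Subgroup G, H.map (QuotientGroup.mk' K) = ⊥ ↔ H ≤ K := fun H => by
        rw [Subgroup.map_eq_bot_iff, QuotientGroup.ker_mk']
      rw [← hb] at h1 h2 ⊢
      simp only [Subgroup.map_commutator] at h1 h2 ⊢
      exact Subgroup.commutator_commutator_eq_bot_of_rotate h1 h2
    refine key _ inferInstance ?_ ?_
    · refine le_trans (Subgroup.commutator_mono ?_ le_rfl) ((ih (i + 1)).trans_eq ?_)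
      · rw [Subgroup.commutator_le]
        exact fun a _ b hb => commutator_mem_gam_succ' hb a
      · congr 1
        omega
    · refine le_trans (Subgroup.commutator_mono (ih i) le_rfl) ?_
      rw [Subgroup.commutator_le]
      exact fun a ha b _ => commutator_mem_gam_succ ha b

theorem commutator_mem_gam {i j : ℕ} {a b : G} (ha : a ∈ gam G i) (hb : b ∈ gam G j) :
    ⁅a, b⁆ ∈ gam G (i + j) :=
  commutator_gam_le i j (Subgroup.commutator_mem_commutator ha hb)

theorem hall_witt (a b c : G) :
    (b⁻¹ * ⁅⁅b, a⁻¹⁆, c⁻¹⁆ * b) * (c⁻¹ * ⁅⁅c, b⁻¹⁆, a⁻¹⁆ * c) * (a⁻¹ * ⁅⁅a, c⁻¹⁆, b⁻¹⁆ * a) = 1 := by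
  simp only [commutatorElement_def]
  group

/-- Inverting one argument inverts a commutator modulo the next term of the series. -/
theorem commutator_inv_right_mem {i j : ℕ} {a b : G} (ha : a ∈ gam G i) (hb : b ∈ gam G j) :
    ⁅a, b⁻¹⁆ * ⁅a, b⁆ ∈ gam G (i + j + 1) := by
  have h := commutator_mem_gam_succ' (inv_mem (commutator_mem_gam ha hb)) b⁻¹
  have h2 : ⁅a, b⁻¹⁆ * ⁅a, b⁆ = ⁅b⁻¹, ⁅a, b⁆⁻¹⁆ := by
    simp only [commutatorElement_def]
    group
  rwa [h2]

theorem mem_centralizerMod_of_le {K : Subgroup G} [K.Normal] {n i j : ℕ}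
    (hK : gam G n ≤ K) {g h : G} (hg : g ∈ gam G i) (hh : h ∈ gam G j) (hn : n ≤ i + j) :
    g ∈ K.centralizerMod h :=
  Subgroup.mem_centralizerMod.2 (hK (gam_antitone G hn (commutator_mem_gam hg hh)))

/-- The Jacobi identity for iterated commutators, in the form of a membership statement. -/
theorem commutator_commutator_mem {K : Subgroup G} [K.Normal] {i j k : ℕ} {a b c : G}
    (hK : gam G (i + j + k + 1) ≤ K) (ha : a ∈ gam G i) (hb : b ∈ gam G j) (hc : c ∈ gam G k)
    (h1 : ⁅⁅a, c⁆, b⁆ ∈ K) (h2 : ⁅a, ⁅b, c⁆⁆ ∈ K) : ⁅⁅a, b⁆, c⁆ ∈ K := by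
  -- The inverses in the Hall–Witt identity are harmless: removing one costs an element of weight `i
  -- + j + k + 1`, which `K` absorbs.
  have hsum : ∀ {x y : G} {p q r : ℕ} {z : G}, x ∈ gam G p → y ∈ gam G q → z ∈ gam G r →
      p + q + r = i + j + k → (⁅x, y⁻¹⁆ ∈ K.centralizerMod z ↔ ⁅x, y⁆ ∈ K.centralizerMod z) := by
    intro x y p q r z hx hy hz hpqr
    have hu : ⁅x, y⁻¹⁆ * ⁅x, y⁆ ∈ K.centralizerMod z :=
      mem_centralizerMod_of_le hK (commutator_inv_right_mem hx hy) hz (by omega)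
    constructor
    · intro h
      exact (Subgroup.mul_mem_cancel_left _ h).1 hu
    · intro h
      exact (Subgroup.mul_mem_cancel_right _ h).1 hu
  have hswap : ∀ {x y z : G}, ⁅x, y⁆ ∈ K.centralizerMod z ↔ ⁅y, x⁆ ∈ K.centralizerMod z := by
    intro x y z
    rw [← commutatorElement_inv, inv_mem_iff]
  have hinv : ∀ {x z : G}, x ∈ K.centralizerMod z⁻¹ ↔ x ∈ K.centralizerMod z := by
    intro x z
    rw [Subgroup.mem_centralizerMod_comm, inv_mem_iff, Subgroup.mem_centralizerMod_comm]
  have hconj : ∀ {x y : G}, x ∈ K → y⁻¹ * x * y ∈ K := by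
    intro x y hx
    simpa using Subgroup.Normal.conj_mem (inferInstance : K.Normal) x hx y⁻¹
  have e2 : ⁅⁅c, b⁻¹⁆, a⁻¹⁆ ∈ K := by
    rw [← Subgroup.mem_centralizerMod, hinv, hsum hc hb ha (by omega), hswap,
      Subgroup.mem_centralizerMod_comm, Subgroup.mem_centralizerMod]
    exact h2
  have e3 : ⁅⁅a, c⁻¹⁆, b⁻¹⁆ ∈ K := by
    rw [← Subgroup.mem_centralizerMod, hinv, hsum ha hc hb (by omega),
      Subgroup.mem_centralizerMod]
    exact h1
  have hw := hall_witt a b c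
  have e1 : b⁻¹ * ⁅⁅b, a⁻¹⁆, c⁻¹⁆ * b ∈ K := by
    rw [mul_assoc] at hw
    rw [eq_inv_of_mul_eq_one_left hw]
    exact inv_mem (mul_mem (hconj e2) (hconj e3))
  have e1' : ⁅⁅b, a⁻¹⁆, c⁻¹⁆ ∈ K := by
    have := Subgroup.Normal.conj_mem (inferInstance : K.Normal) _ e1 b
    simpa [mul_assoc] using this
  rw [← Subgroup.mem_centralizerMod, hinv, hsum hb ha hc (by omega), hswap,
    Subgroup.mem_centralizerMod] at e1'
  exact e1'

/-- Conjugation changes an element of `γ_n` only by a commutator in `γ_{n+1}`. -/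
theorem normal_of_gam_le {K : Subgroup G} {n : ℕ} (h1 : gam G (n + 1) ≤ K) (h2 : K ≤ gam G n) :
    K.Normal := by
  refine ⟨fun a ha g => ?_⟩
  have h3 : ⁅g, a⁆ * a ∈ K := mul_mem (h1 (commutator_mem_gam_succ' (h2 ha) g)) ha
  simpa [commutatorElement_def] using h3

end Commutators

/-! ### Standard commutators span the lower central factors -/

namespace FreeMagma

variable {α G : Type*} [Group G]

/-- The iterated commutator along a tree. -/
def comm (x : α → G) : FreeMagma α → G
  | of a => x a
  | s * t => ⁅comm x s, comm x t⁆

theorem comm_mul (x : α → G) (s t : FreeMagma α) : (s * t).comm x = ⁅s.comm x, t.comm x⁆ := rfl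

theorem comm_mem_gam (x : α → G) (t : FreeMagma α) : t.comm x ∈ gam G t.length := by
  induction t with
  | ih1 a => exact Subgroup.mem_top _
  | ih2 s t hs ht => exact commutator_mem_gam hs ht

variable [LinearOrder α]

/-- The subgroup spanned, modulo `gam G (n + 1)`, by the standard commutators of weight `n` whose
word satisfies `P`. -/
def stdSpan (x : α → G) (n : ℕ) (P : Set (List α)) : Subgroup G :=
  Subgroup.closure {g | ∃ t : FreeMagma α, t.IsStd ∧ t.length = n ∧ t.word ∈ P ∧ t.comm x = g} ⊔
    gam G (n + 1)

theorem gam_le_stdSpan (x : α → G) (n : ℕ) (P : Set (List α)) :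
    gam G (n + 1) ≤ stdSpan x n P := le_sup_right

theorem comm_mem_stdSpan (x : α → G) {P : Set (List α)} {t : FreeMagma α} (ht : t.IsStd)
    (hP : t.word ∈ P) : t.comm x ∈ stdSpan x t.length P :=
  Subgroup.mem_sup_left (Subgroup.subset_closure (Set.mem_ofPred.2 ⟨t, ht, rfl, hP, rfl⟩))

theorem stdSpan_mono (x : α → G) (n : ℕ) {P Q : Set (List α)} (h : P ⊆ Q) :
    stdSpan x n P ≤ stdSpan x n Q := by
  refine sup_le_sup_right (Subgroup.closure_mono ?_) _
  rintro _ ⟨t, h1, h2, h3, h4⟩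
  exact ⟨t, h1, h2, h h3, h4⟩

theorem stdSpan_le_gam (x : α → G) (n : ℕ) (P : Set (List α)) : stdSpan x n P ≤ gam G n := by
  refine sup_le ?_ (gam_succ_le G n)
  rw [Subgroup.closure_le]
  rintro _ ⟨t, -, rfl, -, rfl⟩
  exact t.comm_mem_gam x

instance stdSpan_normal (x : α → G) (n : ℕ) (P : Set (List α)) : (stdSpan x n P).Normal :=
  normal_of_gam_le (gam_le_stdSpan x n P) (stdSpan_le_gam x n P)

/-- To commute with `h` modulo `K` it suffices for the standard generators to do so. -/
theorem stdSpan_le_centralizerMod (x : α → G) {n m j : ℕ} {P : Set (List α)} {K : Subgroup G}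
    [K.Normal] (hK : gam G m ≤ K) {h : G} (hh : h ∈ gam G j) (hm : m ≤ n + 1 + j)
    (hP : ∀ t : FreeMagma α, t.IsStd → t.length = n → t.word ∈ P →
      t.comm x ∈ K.centralizerMod h) : stdSpan x n P ≤ K.centralizerMod h := by
  refine sup_le ?_ fun g hg => mem_centralizerMod_of_le hK hg hh hm
  rw [Subgroup.closure_le]
  rintro _ ⟨t, h1, h2, h3, rfl⟩
  exact hP t h1 h2 h3

/-- Outer induction on the weight, inner induction on the bound `v`. The strict bound in the
conclusion makes the rewriting terminate: replacing a bracket by standard ones lowers the largest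
word that occurs. -/
theorem IsStd.comm_mul_mem_stdSpan [Finite α] (x : α → G) (N : ℕ) :
    ∀ (v : List α), v.length ≤ N → ∀ s t : FreeMagma α, s.IsStd → t.IsStd →
      s.length + t.length = N → s.word ≤ v → t.word ≤ v →
      ⁅s.comm x, t.comm x⁆ ∈ stdSpan x N (Set.Iio v) := by
  induction N using Nat.strong_induction_on with
  | _ N ihN =>
  -- Lexicographic order on all words need not be well-founded; bounded length over a finite
  -- alphabet leaves finitely many words.
  have hwf : {l : List α | l.length ≤ N}.WellFoundedOn (· < ·) :=
    (List.finite_length_le α N).wellFoundedOn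
  intro v hv
  refine hwf.induction (P := fun v => ∀ s t : FreeMagma α, s.IsStd → t.IsStd →
    s.length + t.length = N → s.word ≤ v → t.word ≤ v →
    ⁅s.comm x, t.comm x⁆ ∈ stdSpan x N (Set.Iio v)) hv ?_
  intro v hv ihv
  have hlt : ∀ s t : FreeMagma α, s.IsStd → t.IsStd → s.length + t.length = N →
      s.word < t.word → t.word ≤ v → ⁅s.comm x, t.comm x⁆ ∈ stdSpan x N (Set.Iio v) := by
    intro s t hs ht hN hst htv
    have hst' := ht.word_mul_lt hst
    have hstd : (s * t).IsStd → ⁅s.comm x, t.comm x⁆ ∈ stdSpan x N (Set.Iio v) := fun h => by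
      have hm := comm_mem_stdSpan x (P := Set.Iio v) h (hst'.trans_le htv)
      rwa [length_mul, comm_mul, hN] at hm
    cases s using FreeMagma.recOnMul with
    | ih1 a => exact hstd (.of_mul a ht hst)
    | ih2 s₁ s₂ _ _ =>
      obtain ⟨h1, h2, h12⟩ := hs.factors
      rcases le_or_gt t.word s₂.word with hle | hgt
      · exact hstd (.mul_mul hs ht hst hle)
      have hs1 := s₁.length_pos
      have hs2 := s₂.length_pos
      have ht1 := t.length_pos
      rw [length_mul] at hN
      have hK : gam G (s₁.length + s₂.length + t.length + 1) ≤ stdSpan x N (Set.Iio v) := by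
        rw [hN]
        exact gam_le_stdSpan x N _
      have htl := t.length_word
      -- Once both words are below `t.word ≤ v`, their maximum is a smaller bound for the inner
      -- induction.
      have key : ∀ r q : FreeMagma α, r.IsStd → q.IsStd → r.length + q.length = N →
          r.word < t.word → q.word < t.word →
          ⁅r.comm x, q.comm x⁆ ∈ stdSpan x N (Set.Iio v) := by
        intro r q hr hq hrq hrt hqt
        have hmax : max r.word q.word < v := (max_lt hrt hqt).trans_le htv
        refine stdSpan_mono x N (Set.Iio_subset_Iio hmax.le) (ihv (max r.word q.word) ?_ hmax r q
          hr hq hrq (le_max_left _ _) (le_max_right _ _))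
        have h1 := r.length_word
        have h2 := q.length_word
        rcases max_choice r.word q.word with h | h <;> rw [Set.mem_ofPred_eq, h] <;> omega
      -- Here `s₂ < t`, so `s * t` is not standard. By Jacobi, `[s₁, t]` and `[s₂, t]` are expanded
      -- in lower weight into standard `r < t`, and `key` treats `[r, s₂]` and `[r, s₁]`.
      refine commutator_commutator_mem hK (s₁.comm_mem_gam x) (s₂.comm_mem_gam x)
        (t.comm_mem_gam x) ?_ ?_
      · rw [← Subgroup.mem_centralizerMod]
        refine stdSpan_le_centralizerMod x hK (s₂.comm_mem_gam x) (by omega) ?_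
          (ihN (s₁.length + t.length) (by omega) t.word (by omega) s₁ t h1 ht rfl
            (h12.trans hgt).le le_rfl)
        intro r hr hrl hrv
        rw [Subgroup.mem_centralizerMod]
        exact key r s₂ hr h2 (by omega) hrv hgt
      · rw [← Subgroup.mem_centralizerMod, Subgroup.mem_centralizerMod_comm]
        refine stdSpan_le_centralizerMod x hK (s₁.comm_mem_gam x) (by omega) ?_
          (ihN (s₂.length + t.length) (by omega) t.word (by omega) s₂ t h2 ht rfl
            hgt.le le_rfl)
        intro r hr hrl hrv
        rw [Subgroup.mem_centralizerMod]
        exact key r s₁ hr h1 (by omega) hrv (h12.trans hgt)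
  intro s t hs ht hN hsv htv
  rcases lt_trichotomy s.word t.word with h | h | h
  · exact hlt s t hs ht hN h htv
  · rw [hs.word_injective ht h, commutatorElement_self]
    exact one_mem _
  · rw [← commutatorElement_inv]
    exact inv_mem (hlt t s ht hs (by omega) h hsv)

/-- Modulo the next term, the lower central series is spanned by the standard commutators. -/
theorem gam_le_stdSpan_univ [Finite α] (x : α → G) (hx : Subgroup.closure (Set.range x) = ⊤)
    {n : ℕ} (hn : 1 ≤ n) : gam G n ≤ stdSpan x n Set.univ := by
  induction n, hn using Nat.le_induction with
  | base =>
    rw [gam_one, ← hx, Subgroup.closure_le]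
    rintro _ ⟨a, rfl⟩
    have h := comm_mem_stdSpan x (IsStd.of a) (P := Set.univ) (Set.mem_univ _)
    exact h
  | succ n hn ih =>
    rw [gam_succ G hn, Subgroup.commutator_le]
    intro g hg h _
    rw [← Subgroup.mem_centralizerMod]
    have hh : h ∈ gam G 1 := Subgroup.mem_top h
    have hK := gam_le_stdSpan x (n + 1) Set.univ
    suffices hs : ∀ t : FreeMagma α, t.IsStd → t.length = n → t.word ∈ Set.univ →
        t.comm x ∈ (stdSpan x (n + 1) Set.univ).centralizerMod h from
      stdSpan_le_centralizerMod (K := stdSpan x (n + 1) Set.univ) (m := n + 1 + 1) (n := n)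
        (j := 1) (P := Set.univ) x hK hh le_rfl hs (ih hg)
    intro t ht htn _
    -- With the standard commutator fixed, the other argument may be taken to be a generator, that
    -- is, a standard tree with one leaf.
    have hle : Subgroup.closure (Set.range x) ≤
        (stdSpan x (n + 1) Set.univ).centralizerMod (t.comm x) := by
      rw [Subgroup.closure_le]
      rintro _ ⟨a, rfl⟩
      rw [SetLike.mem_coe, Subgroup.mem_centralizerMod_comm, Subgroup.mem_centralizerMod]
      have hmax : (max t.word (of a).word).length ≤ n + 1 := by
        have := t.length_word
        rcases max_choice t.word (of a).word with h | h
        · rw [h]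
          omega
        · rw [h]
          simp
      exact stdSpan_mono x _ (Set.subset_univ _) (IsStd.comm_mul_mem_stdSpan x (n + 1) _ hmax t
        (of a) ht (.of a) (by rw [htn, length_of]) (le_max_left _ _) (le_max_right _ _))
    rw [Subgroup.mem_centralizerMod_comm]
    exact hle (hx ▸ Subgroup.mem_top h)

end FreeMagma

/-! ### The Magnus representation and its leading terms -/

section Magnus

/-- The ring of endomorphisms of the module of noncommutative formal power series, whose
coefficients are indexed by words. -/
abbrev SeriesEnd (α : Type*) : Type _ := Module.End ℤ (List α → ℤ)

variable {α : Type*}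

namespace SeriesEnd

/-- Left multiplication by the homogeneous element of degree `n` with coefficients `p`. -/
def mulHomogeneous (n : ℕ) (p : List α → ℤ) : SeriesEnd α where
  toFun φ w := if n ≤ w.length then p (w.take n) * φ (w.drop n) else 0
  map_add' φ ψ := by
    funext w
    simp only [Pi.add_apply]
    split_ifs <;> ring
  map_smul' c φ := by
    funext w
    simp only [Pi.smul_apply, smul_eq_mul, RingHom.id_apply]
    split_ifs <;> ring

theorem mulHomogeneous_apply (n : ℕ) (p φ : List α → ℤ) (w : List α) :
    mulHomogeneous n p φ w = if n ≤ w.length then p (w.take n) * φ (w.drop n) else 0 := rfl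

theorem mulHomogeneous_mul (i j : ℕ) (p q : List α → ℤ) :
    mulHomogeneous i p * mulHomogeneous j q =
      mulHomogeneous (i + j) (fun w => p (w.take i) * q (w.drop i)) := by
  refine LinearMap.ext fun φ => funext fun w => ?_
  rw [Module.End.mul_apply, mulHomogeneous_apply, mulHomogeneous_apply, mulHomogeneous_apply]
  by_cases h : i + j ≤ w.length
  · rw [if_pos h, if_pos (by omega), if_pos (by rw [List.length_drop]; omega), List.take_take,
      List.drop_take, List.drop_drop, min_eq_left (by omega), Nat.add_sub_cancel_left, mul_assoc]
  · rw [if_neg h]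
    split_ifs with h1 h2
    · rw [List.length_drop] at h2
      omega
    · rw [mul_zero]
    · rfl

theorem mulHomogeneous_sub (n : ℕ) (p q : List α → ℤ) :
    mulHomogeneous n p - mulHomogeneous n q = mulHomogeneous n (fun w => p w - q w) := by
  refine LinearMap.ext fun φ => funext fun w => ?_
  simp only [LinearMap.sub_apply, Pi.sub_apply, mulHomogeneous_apply]
  split_ifs <;> ring

/-- The endomorphisms raising the order of every series by at least `n`. -/
def raising (α : Type*) (n : ℕ) : AddSubgroup (SeriesEnd α) where
  carrier := {T | ∀ (k : ℕ) (φ : List α → ℤ), (∀ w, w.length < k → φ w = 0) →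
    ∀ w, w.length < k + n → T φ w = 0}
  zero_mem' := fun _ _ _ _ _ => rfl
  add_mem' := fun {S T} hS hT k φ hφ w hw => by
    rw [LinearMap.add_apply, Pi.add_apply, hS k φ hφ w hw, hT k φ hφ w hw, add_zero]
  neg_mem' := fun {T} hT k φ hφ w hw => by
    rw [LinearMap.neg_apply, Pi.neg_apply, hT k φ hφ w hw, neg_zero]

theorem raising_antitone : Antitone (raising α) :=
  fun _ _ h _ hT k φ hφ w hw => hT k φ hφ w (by omega)

theorem mul_mem_raising {i j : ℕ} {S T : SeriesEnd α} (hS : S ∈ raising α i)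
    (hT : T ∈ raising α j) : S * T ∈ raising α (i + j) := fun k φ hφ w hw =>
  hS (k + j) (T φ) (hT k φ hφ) w (by omega)

theorem one_mem_raising : (1 : SeriesEnd α) ∈ raising α 0 := fun _ _ hφ w hw => hφ w hw

theorem mulHomogeneous_mem_raising (n : ℕ) (p : List α → ℤ) :
    mulHomogeneous n p ∈ raising α n := by
  intro k φ hφ w hw
  rw [mulHomogeneous_apply]
  split_ifs with h
  · rw [hφ _ (by rw [List.length_drop]; omega), mul_zero]
  · rfl

variable [DecidableEq α]

/-- Left multiplication by a variable. -/
def mulVar (a : α) : SeriesEnd α := mulHomogeneous 1 (fun w => if w = [a] then 1 else 0)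

theorem mulVar_apply_nil (a : α) (φ : List α → ℤ) : mulVar a φ [] = 0 := rfl

theorem mulVar_apply_cons (a : α) (φ : List α → ℤ) (b : α) (w : List α) :
    mulVar a φ (b :: w) = if b = a then φ w else 0 := by
  simp [mulVar, mulHomogeneous_apply]

/-- The coefficients of `(1 + a)⁻¹ * φ`. -/
def invFun (a : α) (φ : List α → ℤ) : List α → ℤ
  | [] => φ []
  | b :: w => φ (b :: w) - if b = a then invFun a φ w else 0

/-- Left multiplication by `(1 + a)⁻¹`. -/
def invOneAddVar (a : α) : SeriesEnd α where
  toFun := invFun a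
  map_add' φ ψ := by
    funext w
    induction w with
    | nil => rfl
    | cons b w ih =>
      simp only [invFun, Pi.add_apply] at ih ⊢
      rw [ih]
      split_ifs <;> ring
  map_smul' c φ := by
    funext w
    induction w with
    | nil => rfl
    | cons b w ih =>
      simp only [invFun, Pi.smul_apply, smul_eq_mul, RingHom.id_apply] at ih ⊢
      rw [ih]
      split_ifs <;> ring

theorem oneAddVar_mul_inv (a : α) : (1 + mulVar a) * invOneAddVar a = 1 := by
  refine LinearMap.ext fun φ => funext fun w => ?_
  change invFun a φ w + mulVar a (invFun a φ) w = φ w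
  cases w with
  | nil => rw [mulVar_apply_nil, invFun, add_zero]
  | cons b w => rw [mulVar_apply_cons, invFun, sub_add_cancel]

theorem inv_mul_oneAddVar (a : α) : invOneAddVar a * (1 + mulVar a) = 1 := by
  refine LinearMap.ext fun φ => funext fun w => ?_
  change invFun a (φ + mulVar a φ) w = φ w
  induction w with
  | nil => rw [invFun, Pi.add_apply, mulVar_apply_nil, add_zero]
  | cons b w ih => rw [invFun, ih, Pi.add_apply, mulVar_apply_cons, add_sub_cancel_right]

/-- Left multiplication by `1 + a`, as a unit. -/
def oneAddVar (a : α) : (SeriesEnd α)ˣ :=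
  ⟨1 + mulVar a, invOneAddVar a, oneAddVar_mul_inv a, inv_mul_oneAddVar a⟩

omit [DecidableEq α] in
theorem inv_sub_one_mem {u : (SeriesEnd α)ˣ} (h : (u : SeriesEnd α) - 1 ∈ raising α 1)
    (h' : ((u⁻¹ : (SeriesEnd α)ˣ) : SeriesEnd α) ∈ raising α 0) :
    ((u⁻¹ : (SeriesEnd α)ˣ) : SeriesEnd α) - 1 ∈ raising α 1 := by
  have h1 := neg_mem (mul_mem_raising h' h)
  rw [mul_sub, Units.inv_mul, mul_one, neg_sub] at h1
  exact h1

theorem invOneAddVar_mem_raising (a : α) : invOneAddVar a ∈ raising α 0 := by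
  intro k φ hφ w hw
  change invFun a φ w = 0
  induction w with
  | nil => exact hφ _ hw
  | cons b w ih =>
    rw [invFun, hφ _ hw, ih (by rw [List.length_cons] at hw; omega), ite_self, sub_zero]

theorem oneAddVar_sub_one (a : α) : (oneAddVar a : SeriesEnd α) - 1 = mulVar a :=
  add_sub_cancel_left _ _

/-- The units congruent to `1` together with their inverses. -/
def principalUnits (α : Type*) : Subgroup (SeriesEnd α)ˣ where
  carrier := {u | (u : SeriesEnd α) - 1 ∈ raising α 1 ∧
    ((u⁻¹ : (SeriesEnd α)ˣ) : SeriesEnd α) - 1 ∈ raising α 1}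
  one_mem' := by
    simp only [inv_one, Units.val_one, sub_self, Set.mem_ofPred_eq]
    exact ⟨zero_mem _, zero_mem _⟩
  inv_mem' := fun {u} h => ⟨h.2, by rw [inv_inv]; exact h.1⟩
  mul_mem' := by
    have key : ∀ u v : SeriesEnd α, u - 1 ∈ raising α 1 → v - 1 ∈ raising α 1 →
        u * v - 1 ∈ raising α 1 := by
      intro u v hu hv
      have h1 : u * v - 1 = (u - 1) * (v - 1) + (u - 1) + (v - 1) := by noncomm_ring
      rw [h1]
      exact add_mem (add_mem (raising_antitone (by omega) (mul_mem_raising hu hv)) hu) hv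
    intro u v hu hv
    refine ⟨key _ _ hu.1 hv.1, ?_⟩
    rw [mul_inv_rev, Units.val_mul]
    exact key _ _ hv.2 hu.2

theorem oneAddVar_mem_principalUnits (a : α) : oneAddVar a ∈ principalUnits α := by
  have h : (oneAddVar a : SeriesEnd α) - 1 ∈ raising α 1 := by
    rw [oneAddVar_sub_one]
    exact mulHomogeneous_mem_raising _ _
  exact ⟨h, inv_sub_one_mem h (invOneAddVar_mem_raising a)⟩

end SeriesEnd

open SeriesEnd

/-- The Magnus representation of a free group. -/
def magnus [DecidableEq α] {F : Type*} [Group F] (x : FreeGroupBasis α F) :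
    F →* (SeriesEnd α)ˣ := x.lift oneAddVar

variable [DecidableEq α] {F : Type*} [Group F] (x : FreeGroupBasis α F)

theorem magnus_apply (a : α) : magnus x (x a) = oneAddVar a :=
  congrFun (x.lift.symm_apply_apply _) a

theorem magnus_sub_one_mem (g : F) : (magnus x g : SeriesEnd α) - 1 ∈ raising α 1 := by
  have h : Subgroup.closure (Set.range x) ≤ (principalUnits α).comap (magnus x) := by
    rw [Subgroup.closure_le]
    rintro _ ⟨a, rfl⟩
    change magnus x (x a) ∈ principalUnits α
    rw [magnus_apply]
    exact oneAddVar_mem_principalUnits a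
  exact (h (x.closure_range ▸ Subgroup.mem_top g)).1

theorem magnus_mem (g : F) : (magnus x g : SeriesEnd α) ∈ raising α 0 := by
  have h := add_mem (raising_antitone (Nat.zero_le 1) (magnus_sub_one_mem x g)) one_mem_raising
  rwa [sub_add_cancel] at h

/-- Writing `a = g - 1`, `b = h - 1` for the series, `[g, h] - 1 = (ab - ba) g⁻¹h⁻¹`, and the last
factor is 1 up to higher order. -/
theorem magnus_commutator {i j : ℕ} {g h : F} {P Q : SeriesEnd α}
    (hg : (magnus x g : SeriesEnd α) - 1 - P ∈ raising α (i + 1)) (hP : P ∈ raising α i)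
    (hh : (magnus x h : SeriesEnd α) - 1 - Q ∈ raising α (j + 1)) (hQ : Q ∈ raising α j) :
    (magnus x ⁅g, h⁆ : SeriesEnd α) - 1 - (P * Q - Q * P) ∈ raising α (i + j + 1) := by
  have hg' : (magnus x g : SeriesEnd α) - 1 ∈ raising α i := by
    have := add_mem (raising_antitone (Nat.le_succ i) hg) hP
    rwa [sub_add_cancel] at this
  have hh' : (magnus x h : SeriesEnd α) - 1 ∈ raising α j := by
    have := add_mem (raising_antitone (Nat.le_succ j) hh) hQ
    rwa [sub_add_cancel] at this
  set a : SeriesEnd α := (magnus x g : SeriesEnd α) - 1 with ha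
  set b : SeriesEnd α := (magnus x h : SeriesEnd α) - 1 with hb
  set c : SeriesEnd α := (magnus x (g⁻¹ * h⁻¹) : SeriesEnd α) - 1 with hc
  have hc' : c ∈ raising α 1 := magnus_sub_one_mem x _
  have e1 : (magnus x ⁅g, h⁆ : SeriesEnd α) - 1 = (a * b - b * a) * (c + 1) := by
    have h1 : (magnus x (h * g) : SeriesEnd α) * (magnus x (g⁻¹ * h⁻¹) : SeriesEnd α) = 1 := by
      rw [← Units.val_mul, ← map_mul]
      simp
    have h2 : (magnus x ⁅g, h⁆ : SeriesEnd α) =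
        (magnus x (g * h) : SeriesEnd α) * (magnus x (g⁻¹ * h⁻¹) : SeriesEnd α) := by
      rw [← Units.val_mul, ← map_mul, commutatorElement_def]
      simp only [mul_assoc]
    have h3 : a * b - b * a =
        (magnus x (g * h) : SeriesEnd α) - (magnus x (h * g) : SeriesEnd α) := by
      rw [map_mul, map_mul, Units.val_mul, Units.val_mul, ha, hb]
      noncomm_ring
    rw [h3, hc, sub_add_cancel, sub_mul, h1, h2]
  have e2 : (a * b - b * a) * (c + 1) - (P * Q - Q * P) =
      (a * b - b * a) * c + ((a - P) * b + P * (b - Q)) - ((b - Q) * a + Q * (a - P)) := by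
    noncomm_ring
  rw [e1, e2]
  refine sub_mem (add_mem ?_ (add_mem ?_ ?_)) (add_mem ?_ ?_)
  · refine mul_mem_raising (sub_mem (mul_mem_raising hg' hh') ?_) hc'
    rw [add_comm i j]
    exact mul_mem_raising hh' hg'
  · exact raising_antitone (by omega) (mul_mem_raising hg hh')
  · exact raising_antitone (by omega) (mul_mem_raising hP hh)
  · exact raising_antitone (by omega) (mul_mem_raising hh hg')
  · exact raising_antitone (by omega) (mul_mem_raising hQ hg)

/-- The elements whose Magnus series is congruent to `1` up to order `n`. -/
def magnusSubgroup (n : ℕ) : Subgroup F where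
  carrier := {g | (magnus x g : SeriesEnd α) - 1 ∈ raising α n}
  one_mem' := by
    simp only [map_one, Units.val_one, sub_self, Set.mem_ofPred_eq]
    exact zero_mem _
  mul_mem' := fun {g h} hg hh => by
    have h1 : (magnus x (g * h) : SeriesEnd α) - 1 = ((magnus x g : SeriesEnd α) - 1) *
        (magnus x h : SeriesEnd α) + ((magnus x h : SeriesEnd α) - 1) := by
      rw [map_mul, Units.val_mul]
      noncomm_ring
    rw [Set.mem_ofPred_eq, h1]
    exact add_mem (mul_mem_raising hg (magnus_mem x h)) hh
  inv_mem' := fun {g} hg => by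
    have h1 : (magnus x g⁻¹ : SeriesEnd α) - 1 =
        -(((magnus x g : SeriesEnd α) - 1) * (magnus x g⁻¹ : SeriesEnd α)) := by
      rw [map_inv, sub_mul, Units.mul_inv, one_mul, neg_sub]
    rw [Set.mem_ofPred_eq, h1]
    exact neg_mem (mul_mem_raising hg (magnus_mem x _))

theorem gam_le_magnusSubgroup {n : ℕ} (hn : 1 ≤ n) : gam F n ≤ magnusSubgroup x n := by
  induction n, hn using Nat.le_induction with
  | base => exact fun g _ => magnus_sub_one_mem x g
  | succ n hn ih =>
    rw [gam_succ F hn, Subgroup.commutator_le]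
    intro g hg h _
    have hg' : (magnus x g : SeriesEnd α) - 1 ∈ raising α n := ih hg
    have hh' := magnus_sub_one_mem x h
    -- Each series minus 1 serves as its own leading term, with error zero.
    have h1 := magnus_commutator x (i := n) (j := 1) (by rw [sub_self]; exact zero_mem _) hg'
      (by rw [sub_self]; exact zero_mem _) hh'
    have h2 := sub_mem (mul_mem_raising hg' hh')
      (raising_antitone (add_comm n 1).le (mul_mem_raising hh' hg'))
    have h3 := add_mem (raising_antitone (Nat.le_succ (n + 1)) h1) h2
    rwa [sub_add_cancel] at h3

namespace FreeMagma

/-- The coefficients of the Lie polynomial given by a tree. -/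
def coeff : FreeMagma α → List α → ℤ
  | of a => fun w => if w = [a] then 1 else 0
  | s * t => fun w => coeff s (w.take s.length) * coeff t (w.drop s.length) -
      coeff t (w.take t.length) * coeff s (w.drop t.length)

theorem coeff_mul (s t : FreeMagma α) (w : List α) : (s * t).coeff w =
    s.coeff (w.take s.length) * t.coeff (w.drop s.length) -
      t.coeff (w.take t.length) * s.coeff (w.drop t.length) := rfl

theorem magnus_comm (t : FreeMagma α) :
    (magnus x (t.comm x) : SeriesEnd α) - 1 - mulHomogeneous t.length t.coeff ∈
      raising α (t.length + 1) := by
  induction t with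
  | ih1 a =>
    have h : (magnus x ((of a).comm x) : SeriesEnd α) - 1 -
        mulHomogeneous (of a).length (of a).coeff = 0 := by
      change (magnus x (x a) : SeriesEnd α) - 1 - mulVar a = 0
      rw [magnus_apply, oneAddVar_sub_one, sub_self]
    rw [h]
    exact zero_mem _
  | ih2 s t hs ht =>
    have h := magnus_commutator x hs (mulHomogeneous_mem_raising _ _) ht
      (mulHomogeneous_mem_raising _ _)
    rw [mulHomogeneous_mul, mulHomogeneous_mul, add_comm t.length s.length,
      mulHomogeneous_sub] at h
    exact h

end FreeMagma

/-- Reading off a coefficient of degree `n` of the Magnus series is a homomorphism on the `n`-th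
lower central factor. -/
theorem exists_magnusCoeff {n : ℕ} (hn : 1 ≤ n) {w : List α} (hw : w.length = n) :
    ∃ Λ : LowerCentralFactor F n →* Multiplicative ℤ,
      ∀ (t : FreeMagma α) (ht : t.comm x ∈ gam F n), t.length = n →
        Λ ((⟨t.comm x, ht⟩ : gam F n) : LowerCentralFactor F n) =
          Multiplicative.ofAdd (t.coeff w) := by
  -- `δ` is the series 1, so evaluating an operator at `δ` and then at `w` reads a coefficient.
  let δ : List α → ℤ := fun v => if v = [] then 1 else 0
  have hzero : ∀ T ∈ raising α (n + 1), T δ w = 0 := fun T hT =>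
    hT 0 δ (fun _ h => absurd h (Nat.not_lt_zero _)) w (by omega)
  have hadd : ∀ g h : gam F n, ((magnus x (g * h : F) : SeriesEnd α) - 1) δ w =
      ((magnus x g : SeriesEnd α) - 1) δ w + ((magnus x h : SeriesEnd α) - 1) δ w := by
    intro g h
    have e : (magnus x (g * h : F) : SeriesEnd α) - 1 =
        ((magnus x g : SeriesEnd α) - 1) * ((magnus x h : SeriesEnd α) - 1) +
          (((magnus x g : SeriesEnd α) - 1) + ((magnus x h : SeriesEnd α) - 1)) := by
      rw [map_mul, Units.val_mul]
      noncomm_ring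
    -- The cross term has order `2n ≥ n + 1`, because `n ≥ 1`; hence the coefficient is additive.
    have hm := mul_mem_raising (gam_le_magnusSubgroup x hn g.2) (gam_le_magnusSubgroup x hn h.2)
    rw [e, LinearMap.add_apply, Pi.add_apply, hzero _ (raising_antitone (by omega) hm), zero_add]
    rfl
  let L : gam F n →* Multiplicative ℤ := MonoidHom.mk'
    (fun g => Multiplicative.ofAdd (((magnus x g : SeriesEnd α) - 1) δ w))
    (fun g h => congrArg Multiplicative.ofAdd (hadd g h))
  refine ⟨QuotientGroup.lift _ L fun g hg => congrArg Multiplicative.ofAdd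
    (hzero _ (gam_le_magnusSubgroup x (by omega) (Subgroup.mem_subgroupOf.1 hg))), ?_⟩
  intro t ht htn
  subst htn
  change Multiplicative.ofAdd (((magnus x (t.comm x) : SeriesEnd α) - 1) δ w) = _
  congr 1
  have h := hzero _ (t.magnus_comm x)
  rw [LinearMap.sub_apply, Pi.sub_apply, sub_eq_zero] at h
  rw [h, mulHomogeneous_apply, if_pos hw.ge, ← hw, List.take_length, List.drop_length]
  simp [δ]

end Magnus

/-! ### Triangularity and the free lower central factors -/

namespace FreeMagma

variable {α : Type*} [LinearOrder α]

/-- For `s < t` with `t` Lyndon, the word `st` precedes `ts`. So the subtracted product `ts`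
contributes nothing at or below `st`, and the product `st` inherits its leading word from the
factors. -/
theorem IsStd.coeff_triangular {t : FreeMagma α} (h : t.IsStd) :
    t.coeff t.word = 1 ∧ ∀ w : List α, w.length = t.length → w < t.word → t.coeff w = 0 := by
  induction t with
  | ih1 a =>
    refine ⟨if_pos rfl, fun w _ hw => if_neg ?_⟩
    rintro rfl
    exact lt_irrefl _ hw
  | ih2 s t hs ht =>
    obtain ⟨h1, h2, h12⟩ := h.factors
    obtain ⟨hs1, hs2⟩ := hs h1
    obtain ⟨ht1, ht2⟩ := ht h2
    have hts : s.word ++ t.word < t.word ++ s.word :=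
      (h2.word_mul_lt h12).trans (List.lt_append_of_ne_nil _ s.word_ne_nil)
    have hzero : ∀ w : List α, w.length = s.length + t.length → w ≤ s.word ++ t.word →
        t.coeff (w.take t.length) * s.coeff (w.drop t.length) = 0 := by
      intro w hw hle
      have hl : (w.take t.length).length = t.length := by rw [List.length_take]; omega
      have hl' : (w.drop t.length).length = s.length := by rw [List.length_drop]; omega
      rcases lt_trichotomy (w.take t.length) t.word with hlt | heq | hgt
      · rw [ht2 _ hl hlt, zero_mul]
      · rcases lt_or_ge (w.drop t.length) s.word with hlt | hge
        · rw [hs2 _ hl' hlt, mul_zero]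
        · exfalso
          rw [← List.take_append_drop t.length w, heq] at hle
          rcases hge.eq_or_lt with hge | hge
          · rw [← hge] at hle
            exact absurd hts (not_lt.2 hle)
          · exact absurd (hts.trans (List.append_lt_append_left_of_lt _ hge)) (not_lt.2 hle)
      · exfalso
        have := List.append_lt_append_of_length_eq hgt (by rw [hl, length_word]) s.word
          (w.drop t.length)
        rw [List.take_append_drop] at this
        exact absurd (hts.trans this) (not_lt.2 hle)
    constructor
    · rw [coeff_mul, word_mul, hzero _ (by simp [length_word]) le_rfl, ← length_word s,
        List.take_left, List.drop_left, hs1, ht1]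
      norm_num
    · intro w hw hlt
      rw [length_mul] at hw
      rw [word_mul] at hlt
      rw [coeff_mul, hzero w hw hlt.le, sub_zero]
      have hl : (w.take s.length).length = s.length := by rw [List.length_take]; omega
      have hl' : (w.drop s.length).length = t.length := by rw [List.length_drop]; omega
      rcases lt_trichotomy (w.take s.length) s.word with h3 | heq | hgt
      · rw [hs2 _ hl h3, zero_mul]
      · rcases lt_or_ge (w.drop s.length) t.word with h3 | hge
        · rw [ht2 _ hl' h3, mul_zero]
        · exfalso
          rw [← List.take_append_drop s.length w, heq] at hlt
          rcases hge.eq_or_lt with hge | hge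
          · rw [← hge] at hlt
            exact lt_irrefl _ hlt
          · exact lt_asymm hlt (List.append_lt_append_left_of_lt _ hge)
      · exfalso
        have := List.append_lt_append_of_length_eq hgt (by rw [hl, length_word]) t.word
          (w.drop s.length)
        rw [List.take_append_drop] at this
        exact lt_asymm hlt this

end FreeMagma

/-- The lower central factors of a free group of finite rank are free abelian of finite rank. -/
theorem FreeGroupBasis.exists_freelyGeneratesAb {α F : Type*} [LinearOrder α] [Finite α] [Group F]
    (x : FreeGroupBasis α F) {n : ℕ} (hn : 1 ≤ n) :
    ∃ (m : ℕ) (v : Fin m → gam F n),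
      FreelyGeneratesAb (fun j => (v j : LowerCentralFactor F n)) := by
  classical
  let ι := {t : FreeMagma α // t.IsStd ∧ t.length = n}
  have : Finite ι := by
    have : Finite {l : List α // l.length ≤ n} := (List.finite_length_le α n).to_subtype
    refine Finite.of_injective
      (fun t : ι => (⟨t.1.word, by rw [t.1.length_word]; exact t.2.2.le⟩ :
        {l : List α // l.length ≤ n})) ?_
    intro s t hst
    exact Subtype.ext (s.2.1.word_injective t.2.1 (congrArg Subtype.val hst))
  have := Fintype.ofFinite ι
  have hmem : ∀ t : ι, t.1.comm x ∈ gam F n := fun t => by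
    have := t.1.comm_mem_gam x
    rwa [t.2.2] at this
  let u : ι → LowerCentralFactor F n := fun t => ((⟨t.1.comm x, hmem t⟩ : gam F n) :)
  have hu : FreelyGeneratesAb u := by
    refine FreelyGeneratesAb.of_injective (MonoidHom.id _) Function.injective_id _ ?_ ?_
    · rw [eq_top_iff]
      intro a _
      obtain ⟨⟨a, ha⟩, rfl⟩ := QuotientGroup.mk_surjective a
      let C : Subgroup F := ((Subgroup.closure (Set.range u)).comap
        (QuotientGroup.mk' ((gam F (n + 1)).subgroupOf (gam F n)))).map (gam F n).subtype
      have hle : FreeMagma.stdSpan x n Set.univ ≤ C := by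
        refine sup_le ?_ ?_
        · rw [Subgroup.closure_le]
          rintro _ ⟨t, h1, h2, -, rfl⟩
          exact ⟨⟨t.comm x, hmem ⟨t, h1, h2⟩⟩, Subgroup.subset_closure ⟨⟨t, h1, h2⟩, rfl⟩, rfl⟩
        · intro g hg
          refine ⟨⟨g, gam_succ_le F n hg⟩, ?_, rfl⟩
          have h1 : ((⟨g, gam_succ_le F n hg⟩ : gam F n) : LowerCentralFactor F n) = 1 := by
            rw [QuotientGroup.eq_one_iff, Subgroup.mem_subgroupOf]
            exact hg
          change ((⟨g, gam_succ_le F n hg⟩ : gam F n) : LowerCentralFactor F n) ∈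
            Subgroup.closure (Set.range u)
          rw [h1]
          exact one_mem _
      obtain ⟨b, hb, hba⟩ := hle (FreeMagma.gam_le_stdSpan_univ x x.closure_range hn ha)
      have : b = ⟨a, ha⟩ := Subtype.ext hba
      subst this
      exact hb
    · intro c hc
      by_contra hne
      obtain ⟨i, hi⟩ : ∃ i, c i ≠ 0 := Function.ne_iff.1 hne
      -- At the smallest word occurring in the relation only its own commutator has a nonzero
      -- coefficient, namely 1.
      obtain ⟨t, ht, hmin⟩ := Finset.exists_min_image (Finset.univ.filter fun i => c i ≠ 0)
        (fun t : ι => t.1.word) ⟨i, by simpa using hi⟩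
      rw [Finset.mem_filter] at ht
      obtain ⟨Λ, hΛ⟩ := exists_magnusCoeff x hn (w := t.1.word) (t.1.length_word.trans t.2.2)
      have h1 := congrArg (fun a => (Λ a).toAdd) hc
      simp only [MonoidHom.id_apply, map_prod, map_zpow, map_one, toAdd_one, toAdd_prod,
        toAdd_zpow, u] at h1
      rw [Finset.sum_eq_single t, hΛ _ _ t.2.2, t.2.1.coeff_triangular.1] at h1
      · exact ht.2 (by simpa using h1)
      · intro s _ hst
        rw [hΛ _ _ s.2.2]
        by_cases hs : c s = 0
        · rw [hs, zero_smul]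
        · have hle := hmin s (by simpa using hs)
          have hlt : t.1.word < s.1.word := lt_of_le_of_ne hle fun h =>
            hst (Subtype.ext (s.2.1.word_injective t.2.1 h.symm))
          rw [s.2.1.coeff_triangular.2 _ (by rw [t.1.length_word, t.2.2, s.2.2]) hlt]
          simp
      · intro h
        exact absurd (Finset.mem_univ t) h
  let σ := Fintype.equivFin ι
  exact ⟨Fintype.card ι, fun j => ⟨(σ.symm j).1.comm x, hmem _⟩, hu.reindex σ.symm⟩

/-! ### Smith normal form -/

section Smith

/-- A set of integer matrices closed under the elementary row and column operations. -/
structure ElementaryClosed {r m : ℕ} (P : (Fin r → Fin m → ℤ) → Prop) : Prop where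
  rowSwap : ∀ M i j, P M → P fun k => M (Equiv.swap i j k)
  colSwap : ∀ M i j, P M → P fun k l => M k (Equiv.swap i j l)
  rowAdd : ∀ M k (c : Fin r → ℤ), c k = 0 → P M → P fun i j => M i j + c i * M k j
  colAdd : ∀ M k l (c : ℤ), l ≠ k → P M → P fun i j => M i j + if j = l then c * M i k else 0
  rowNeg : ∀ M k, P M → P fun i j => if i = k then -M i j else M i j

theorem ElementaryClosed.colAdd_all {r m : ℕ} {P : (Fin r → Fin m → ℤ) → Prop}
    (hP : ElementaryClosed P) {M : Fin r → Fin m → ℤ} (hM : P M) (k : Fin m) (c : Fin m → ℤ)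
    (hc : c k = 0) : P fun i j => M i j + c j * M i k := by
  have key : ∀ T : Finset (Fin m), k ∉ T →
      P fun i j => M i j + if j ∈ T then c j * M i k else 0 := by
    intro T
    induction T using Finset.induction_on with
    | empty => simpa using hM
    | insert l T hl ih =>
      intro hk
      rw [Finset.mem_insert, not_or] at hk
      have h := hP.colAdd _ k l (c l) (Ne.symm hk.1) (ih hk.2)
      convert h using 3 with i j
      by_cases hj : j = l
      · subst hj
        simp [hl, hk.2]
      · simp [hj]
  convert key (Finset.univ.erase k) (by simp) using 3 with i j
  by_cases hj : j = k
  · subst hj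
    simp [hc]
  · simp [hj]

/-- The block matrix with blocks `a` and `N`. -/
def cornerMatrix {r m : ℕ} (a : ℤ) (N : Fin r → Fin m → ℤ) : Fin (r + 1) → Fin (m + 1) → ℤ :=
  Fin.cons (Fin.cons a 0) fun i => Fin.cons 0 (N i)

section

variable {r m : ℕ} (a : ℤ) (N : Fin r → Fin m → ℤ)

@[simp] theorem cornerMatrix_zero_zero : cornerMatrix a N 0 0 = a := rfl

@[simp] theorem cornerMatrix_zero_succ (j : Fin m) : cornerMatrix a N 0 j.succ = 0 := rfl

@[simp] theorem cornerMatrix_succ_zero (i : Fin r) : cornerMatrix a N i.succ 0 = 0 := rfl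

@[simp] theorem cornerMatrix_succ_succ (i : Fin r) (j : Fin m) :
    cornerMatrix a N i.succ j.succ = N i j := rfl

end

theorem Fin.swap_succ_succ {n : ℕ} (i j k : Fin n) :
    Equiv.swap i.succ j.succ k.succ = (Equiv.swap i j k).succ :=
  (Fin.succ_injective n).swap_apply i j k

theorem Fin.swap_succ_zero {n : ℕ} (i j : Fin n) : Equiv.swap i.succ j.succ 0 = 0 :=
  Equiv.swap_apply_of_ne_of_ne (Fin.succ_ne_zero i).symm (Fin.succ_ne_zero j).symm

theorem ElementaryClosed.corner {r m : ℕ} {P : (Fin (r + 1) → Fin (m + 1) → ℤ) → Prop}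
    (hP : ElementaryClosed P) (a : ℤ) : ElementaryClosed fun N => P (cornerMatrix a N) where
  rowSwap N i j h := by
    convert hP.rowSwap _ i.succ j.succ h using 1
    funext k l
    cases k using Fin.cases <;> cases l using Fin.cases <;>
      simp [Fin.swap_succ_succ, Fin.swap_succ_zero]
  colSwap N i j h := by
    convert hP.colSwap _ i.succ j.succ h using 1
    funext k l
    cases k using Fin.cases <;> cases l using Fin.cases <;>
      simp [Fin.swap_succ_succ, Fin.swap_succ_zero]
  rowAdd N k c hc h := by
    convert hP.rowAdd _ k.succ (Fin.cons 0 c : Fin (r + 1) → ℤ) hc h using 1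
    funext i j
    cases i using Fin.cases <;> cases j using Fin.cases <;> simp
  colAdd N k l c hkl h := by
    convert hP.colAdd _ k.succ l.succ c (fun h => hkl (Fin.succ_injective m h)) h using 1
    funext i j
    cases i using Fin.cases <;> cases j using Fin.cases <;> simp [(Fin.succ_ne_zero _).symm]
  rowNeg N k h := by
    convert hP.rowNeg _ k.succ h using 1
    funext i j
    cases i using Fin.cases <;> cases j using Fin.cases <;> simp [(Fin.succ_ne_zero _).symm]

/-- Smith normal form: a nonempty set of integer matrices closed under elementary operations
contains a diagonal matrix with positive entries dividing each other, followed by zeros. -/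
theorem ElementaryClosed.exists_diagonal {r m : ℕ} {P : (Fin r → Fin m → ℤ) → Prop}
    (hP : ElementaryClosed P) {M : Fin r → Fin m → ℤ} (hM : P M) :
    ∃ (s : ℕ) (d : ℕ → ℕ), s ≤ r ∧ s ≤ m ∧ (∀ i < s, 0 < d i) ∧
      (∀ i j, i ≤ j → j < s → d i ∣ d j) ∧
      P fun i j => if i.1 = j.1 ∧ i.1 < s then (d i.1 : ℤ) else 0 := by
  induction r generalizing m with
  | zero =>
    refine ⟨0, fun _ => 1, le_rfl, Nat.zero_le _, by simp, by simp, ?_⟩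
    convert hM using 1
  | succ r ih =>
  by_cases hall : ∀ N, P N → N = 0
  · refine ⟨0, fun _ => 1, Nat.zero_le _, Nat.zero_le _, by simp, by simp, ?_⟩
    convert hM using 1
    rw [hall M hM]
    funext i j
    simp
  push Not at hall
  obtain ⟨N₀, hN₀, hne⟩ := hall
  obtain ⟨i₀, hi₀⟩ := Function.ne_iff.1 hne
  obtain ⟨j₀, hj₀⟩ := Function.ne_iff.1 hi₀
  obtain ⟨m, rfl⟩ : ∃ m', m = m' + 1 := Nat.exists_eq_succ_of_ne_zero (by
    rintro rfl
    exact j₀.elim0)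
  -- The pivot is minimal in absolute value over all nonzero entries of all matrices in `P`;
  -- division by it therefore leaves remainder zero, with no Euclidean loop.
  let S : Set ℕ := {k | ∃ N i j, P N ∧ N i j ≠ 0 ∧ (N i j).natAbs = k}
  have hS : S.Nonempty := ⟨_, N₀, i₀, j₀, hN₀, hj₀, rfl⟩
  obtain ⟨N₁, i₁, j₁, hN₁, hne₁, habs⟩ := Nat.sInf_mem hS
  have hmin : ∀ N i j, P N → N i j ≠ 0 → sInf S ≤ (N i j).natAbs := fun N i j hN h =>
    Nat.sInf_le ⟨N, i, j, hN, h, rfl⟩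
  obtain ⟨a, ha⟩ : ∃ a, a = sInf S := ⟨_, rfl⟩
  rw [← ha] at habs hmin
  have ha0 : 0 < a := habs ▸ Int.natAbs_pos.2 hne₁
  obtain ⟨N₂, hN₂, h00⟩ : ∃ N, P N ∧ N 0 0 = (a : ℤ) := by
    have h1 := hP.colSwap _ 0 j₁ (hP.rowSwap _ 0 i₁ hN₁)
    rcases Int.natAbs_eq (N₁ i₁ j₁) with h | h
    · exact ⟨_, h1, by simp only [Equiv.swap_apply_left]; rw [h, habs]⟩
    · exact ⟨_, hP.rowNeg _ 0 h1, by
        simp only [Equiv.swap_apply_left, if_true]; rw [h, habs, neg_neg]⟩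
  have hsmall : ∀ N i j, P N → 0 ≤ N i j → N i j < a → N i j = 0 := by
    intro N i j hN h0 hlt
    by_contra hne
    have := hmin N i j hN hne
    omega
  have hcol : ∀ N, P N → N 0 0 = (a : ℤ) → ∀ i, i ≠ 0 → (a : ℤ) ∣ N i 0 := by
    intro N hN h00 i hi
    have h1 := hP.rowAdd N 0 (Pi.single i (-(N i 0 / a))) (by simp [hi.symm]) hN
    have h2 := hsmall _ i 0 h1
    simp only [Pi.single_eq_same, h00] at h2
    have h3 : N i 0 + -(N i 0 / a) * a = N i 0 % a := by
      rw [Int.emod_def]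
      ring
    rw [h3] at h2
    exact Int.dvd_of_emod_eq_zero
      (h2 (Int.emod_nonneg _ (by omega)) (Int.emod_lt_of_pos _ (by omega)))
  have hrow : ∀ N, P N → N 0 0 = (a : ℤ) → ∀ j, j ≠ 0 → (a : ℤ) ∣ N 0 j := by
    intro N hN h00 j hj
    have h1 := hP.colAdd N 0 j (-(N 0 j / a)) hj hN
    have h2 := hsmall _ 0 j h1
    simp only [if_true, h00] at h2
    have h3 : N 0 j + -(N 0 j / a) * a = N 0 j % a := by
      rw [Int.emod_def]
      ring
    rw [h3] at h2
    exact Int.dvd_of_emod_eq_zero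
      (h2 (Int.emod_nonneg _ (by omega)) (Int.emod_lt_of_pos _ (by omega)))
  obtain ⟨N₃, hN₃, h00', hz⟩ : ∃ N, P N ∧ N 0 0 = (a : ℤ) ∧ ∀ i, i ≠ 0 → N i 0 = 0 := by
    refine ⟨_, hP.rowAdd N₂ 0 (fun i => if i = 0 then 0 else -(N₂ i 0 / a)) (if_pos rfl) hN₂,
      by simp [h00], fun i hi => ?_⟩
    have := Int.ediv_mul_cancel (hcol N₂ hN₂ h00 i hi)
    simp only [if_neg hi, h00]
    rw [neg_mul, this, add_neg_cancel]
  obtain ⟨N, hN⟩ : ∃ N, P (cornerMatrix a N) := by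
    refine ⟨fun i j => N₃ i.succ j.succ, ?_⟩
    convert hP.colAdd_all hN₃ 0 (fun j => if j = 0 then 0 else -(N₃ 0 j / a)) (if_pos rfl) using 1
    funext i j
    cases i using Fin.cases with
    | zero =>
      cases j using Fin.cases with
      | zero => simp [h00']
      | succ j =>
        have := Int.ediv_mul_cancel (hrow N₃ hN₃ h00' j.succ (Fin.succ_ne_zero j))
        simp only [cornerMatrix_zero_succ, if_neg (Fin.succ_ne_zero j), h00']
        rw [neg_mul, this, add_neg_cancel]
    | succ i =>
      cases j using Fin.cases with
      | zero => simp [hz _ (Fin.succ_ne_zero i)]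
      | succ j => simp [hz _ (Fin.succ_ne_zero i)]
  have hdvd : ∀ N, P (cornerMatrix a N) → ∀ i j, (a : ℤ) ∣ N i j := by
    intro N hN i j
    -- Adding a lower row to the first keeps the corner `a` and moves the entry into the pivot row,
    -- where divisibility is known.
    have h1 := hP.rowAdd _ i.succ (Pi.single 0 1) (by simp) hN
    simpa using hrow _ h1 (by simp) j.succ (Fin.succ_ne_zero j)
  obtain ⟨s, d, hsr, hsm, hpos, hdd, hD⟩ := ih (hP.corner a) hN
  have had : ∀ i < s, a ∣ d i := by
    intro i hi
    have := hdvd _ hD ⟨i, by omega⟩ ⟨i, by omega⟩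
    simpa [hi, Int.natCast_dvd_natCast] using this
  refine ⟨s + 1, fun i => Nat.casesOn i a d, by omega, by omega, ?_, ?_, ?_⟩
  · rintro (_ | i) hi
    · exact ha0
    · exact hpos i (by omega)
  · rintro (_ | i) (_ | j) hij hj
    · exact dvd_rfl
    · exact had j (by omega)
    · omega
    · exact hdd i j (by omega) (by omega)
  · convert hD using 1
    funext i j
    cases i using Fin.cases <;> cases j using Fin.cases <;> simp

end Smith

/-! ### Nielsen transformations -/

section Nielsen

/-- A set of finite tuples closed under Nielsen transformations. -/
structure NielsenClosed {r : ℕ} {K : Type*} [Group K] (Q : (Fin r → K) → Prop) : Prop where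
  swap : ∀ h i j, Q h → Q fun k => h (Equiv.swap i j k)
  mul : ∀ h k (c : Fin r → ℤ), c k = 0 → Q h → Q fun i => h i * h k ^ c i
  inv : ∀ h k, Q h → Q fun i => if i = k then (h i)⁻¹ else h i

/-- The exponent matrices of tuples in `Q` relative to tuples in `Q'` form an elementary-closed set:
moves on `h` act on rows and moves on `x` on columns. -/
theorem NielsenClosed.exists_diagonal {r m : ℕ} {K K' V : Type*} [Group K] [Group K'] [CommGroup V]
    (f : K →* V) (g : K' →* V) {Q : (Fin r → K) → Prop} (hQ : NielsenClosed Q)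
    {Q' : (Fin m → K') → Prop} (hQ' : NielsenClosed Q') {h : Fin r → K} {x : Fin m → K'}
    (hh : Q h) (hx : Q' x) (hM : ∀ i, ∃ c : Fin m → ℤ, f (h i) = ∏ j, g (x j) ^ c j) :
    ∃ (s : ℕ) (d : ℕ → ℕ) (h : Fin r → K) (x : Fin m → K') (_ : s ≤ r) (hsm : s ≤ m),
      Q h ∧ Q' x ∧ (∀ i < s, 0 < d i) ∧ (∀ i j, i ≤ j → j < s → d i ∣ d j) ∧
      (∀ i (hi : i.1 < s), f (h i) = g (x (Fin.castLE hsm ⟨i.1, hi⟩)) ^ d i) ∧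
      ∀ i, s ≤ i.1 → f (h i) = 1 := by
  choose M hM using hM
  let P : (Fin r → Fin m → ℤ) → Prop := fun M =>
    ∃ h x, Q h ∧ Q' x ∧ ∀ i, f (h i) = ∏ j, g (x j) ^ M i j
  have hP : ElementaryClosed P := by
    constructor
    · rintro M i j ⟨h, x, hh, hx, hM⟩
      exact ⟨_, x, hQ.swap h i j hh, hx, fun k => hM _⟩
    · rintro M i j ⟨h, x, hh, hx, hM⟩
      refine ⟨h, _, hh, hQ'.swap x i j hx, fun k => ?_⟩
      rw [hM]
      exact (Equiv.prod_comp (Equiv.swap i j) fun l => g (x l) ^ M k l).symm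
    · rintro M k c hc ⟨h, x, hh, hx, hM⟩
      refine ⟨_, x, hQ.mul h k c hc hh, hx, fun i => ?_⟩
      simp only [map_mul, map_zpow, hM, zpow_add, Finset.prod_mul_distrib, ← Finset.prod_zpow,
        ← zpow_mul]
      congr 1
      exact Finset.prod_congr rfl fun j _ => by rw [mul_comm]
    · rintro M k l c hkl ⟨h, x, hh, hx, hM⟩
      -- Column operations are contragredient: adding `c` times column `k` to column `l` means
      -- replacing `x_k` by `x_k x_l ^ (-c)`.
      refine ⟨h, _, hh, hQ'.mul x l (Pi.single k (-c)) (by simp [hkl]) hx, fun i => ?_⟩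
      rw [hM]
      have h1 : ∀ j, g (x j * x l ^ (Pi.single k (-c) : Fin m → ℤ) j) ^
          (M i j + if j = l then c * M i k else 0) = g (x j) ^ M i j *
            ((if j = l then g (x l) ^ (c * M i k) else 1) *
              if j = k then g (x l) ^ (-(c * M i k)) else 1) := by
        intro j
        rcases eq_or_ne j k with rfl | hjk
        · rw [Pi.single_eq_same, if_neg hkl.symm, if_neg hkl.symm, if_pos rfl, add_zero, map_mul,
            map_zpow, mul_zpow, one_mul, ← zpow_mul, neg_mul]
        · rw [Pi.single_eq_of_ne hjk, zpow_zero, mul_one, if_neg hjk, mul_one]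
          split_ifs with hjl
          · rw [zpow_add, hjl]
          · rw [add_zero, mul_one]
      rw [Finset.prod_congr rfl fun j _ => h1 j, Finset.prod_mul_distrib,
        Finset.prod_mul_distrib, Finset.prod_ite_eq', Finset.prod_ite_eq', if_pos (Finset.mem_univ _),
        if_pos (Finset.mem_univ _), ← zpow_add, add_neg_cancel, zpow_zero, mul_one]
    · rintro M k ⟨h, x, hh, hx, hM⟩
      refine ⟨_, x, hQ.inv h k hh, hx, fun i => ?_⟩
      by_cases hi : i = k
      · simp only [if_pos hi, map_inv, hM, zpow_neg, Finset.prod_inv_distrib]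
      · simp only [if_neg hi, hM]
  obtain ⟨s, d, hsr, hsm, hpos, hdd, h', x', hh', hx', hD⟩ :=
    hP.exists_diagonal (M := M) ⟨h, x, hh, hx, hM⟩
  refine ⟨s, d, h', x', hsr, hsm, hh', hx', hpos, hdd, fun i hi => ?_, fun i hi => ?_⟩
  · rw [hD, Finset.prod_eq_single (Fin.castLE hsm ⟨i.1, hi⟩)]
    · simp [hi]
    · intro j _ hj
      have h1 : ¬(i.1 = j.1 ∧ i.1 < s) := fun h => hj (Fin.ext h.1.symm)
      simp only [if_neg h1, zpow_zero]
    · simp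
  · rw [hD]
    refine Finset.prod_eq_one fun j _ => ?_
    have h1 : ¬(i.1 = j.1 ∧ i.1 < s) := fun h => absurd h.2 (not_lt.2 hi)
    simp only [if_neg h1, zpow_zero]

/-- Each move is undone inside the new subgroup; `c k = 0` ensures that the multiplier `h k` is
still among the entries. -/
theorem nielsenClosed_closure {r : ℕ} {K F : Type*} [Group K] [Group F] (f : K →* F)
    (H : Subgroup F) :
    NielsenClosed fun h : Fin r → K => Subgroup.closure (Set.range fun i => f (h i)) = H := by
  have key : ∀ h h' : Fin r → K,
      (∀ i, f (h' i) ∈ Subgroup.closure (Set.range fun i => f (h i))) →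
      (∀ i, f (h i) ∈ Subgroup.closure (Set.range fun i => f (h' i))) →
      Subgroup.closure (Set.range fun i => f (h i)) = H →
      Subgroup.closure (Set.range fun i => f (h' i)) = H := by
    rintro h h' h1 h2 rfl
    refine le_antisymm ?_ ?_ <;> rw [Subgroup.closure_le]
    · rintro _ ⟨i, rfl⟩
      exact h1 i
    · rintro _ ⟨i, rfl⟩
      exact h2 i
  have hsub : ∀ (h : Fin r → K) i, f (h i) ∈ Subgroup.closure (Set.range fun i => f (h i)) :=
    fun h i => Subgroup.subset_closure ⟨i, rfl⟩
  constructor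
  · intro h i j hh
    refine key h _ (fun k => hsub h _) (fun k => ?_) hh
    have := hsub (fun k => h (Equiv.swap i j k)) (Equiv.swap i j k)
    simpa only [Equiv.swap_apply_self] using this
  · intro h k c hc hh
    refine key h _ (fun i => ?_) (fun i => ?_) hh
    · rw [map_mul, map_zpow]
      exact mul_mem (hsub h i) (zpow_mem (hsub h k) _)
    · have h1 := hsub (fun i => h i * h k ^ c i) i
      have h2 := hsub (fun i => h i * h k ^ c i) k
      simp only [hc, zpow_zero, mul_one] at h2
      have h3 := mul_mem h1 (zpow_mem h2 (-c i))
      simpa only [map_mul, map_zpow, mul_assoc, ← zpow_add, add_neg_cancel, zpow_zero, mul_one]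
        using h3
  · intro h k hh
    refine key h _ (fun i => ?_) (fun i => ?_) hh
    · split_ifs
      · rw [map_inv]
        exact inv_mem (hsub h i)
      · exact hsub h i
    · have h1 := hsub (fun i => if i = k then (h i)⁻¹ else h i) i
      by_cases hi : i = k
      · simp only [if_pos hi, map_inv] at h1
        exact inv_mem_iff.1 h1
      · simp only [if_neg hi] at h1
        exact h1

theorem nielsenClosed_freelyGeneratesAb {r : ℕ} {K V : Type*} [Group K] [CommGroup V] (f : K →* V) :
    NielsenClosed fun x : Fin r → K => FreelyGeneratesAb fun i => f (x i) := by
  have key : ∀ x : Fin r → K, Subgroup.closure (Set.range fun i => f (x i)) = ⊤ →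
      (∀ c : Fin r → ℤ, ∏ i, f (x i) ^ c i = 1 → c = 0) →
      FreelyGeneratesAb fun i => f (x i) := fun x h1 h2 =>
    FreelyGeneratesAb.of_injective (MonoidHom.id V) Function.injective_id _ h1 h2
  have hcl := nielsenClosed_closure (r := r) f ⊤
  constructor
  · intro x i j hx
    exact hx.reindex (Equiv.swap i j)
  · intro x k c hc hx
    refine key _ (hcl.mul x k c hc hx.closure_eq_top) fun e he => ?_
    have h1 : ∀ i, f (x i * x k ^ c i) ^ e i = f (x i) ^ e i * f (x k) ^ (c i * e i) := by
      intro i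
      rw [map_mul, map_zpow, mul_zpow, zpow_mul]
    have h2 : ∀ s : Finset (Fin r), ∏ i ∈ s, f (x k) ^ (c i * e i) =
        f (x k) ^ ∑ i ∈ s, c i * e i := by
      intro s
      induction s using Finset.cons_induction with
      | empty => simp
      | cons a s ha ih => rw [Finset.prod_cons, Finset.sum_cons, ih, zpow_add]
    rw [Finset.prod_congr rfl fun i _ => h1 i, Finset.prod_mul_distrib, h2] at he
    -- A relation `e` for the new family is one for the old, with `∑ c_j e_j` added to the exponent
    -- of `x_k`.
    have h0 := hx.eq_zero_of_prod_eq_one Function.injective_id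
      (fun i => e i + if i = k then ∑ j, c j * e j else 0) (by
        rw [← he]
        simp only [id_eq, zpow_add, Finset.prod_mul_distrib]
        congr 1
        rw [Finset.prod_eq_single k (fun j _ hj => by rw [if_neg hj, zpow_zero]) (by simp),
          if_pos rfl])
    have h3 : ∀ i, i ≠ k → e i = 0 := fun i hi => by simpa [hi] using congrFun h0 i
    have h4 : ∑ j, c j * e j = 0 := Finset.sum_eq_zero fun j _ => by
      rcases eq_or_ne j k with rfl | hj
      · rw [hc, zero_mul]
      · rw [h3 j hj, mul_zero]
    funext i
    have h5 := congrFun h0 i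
    simpa [h4] using h5
  · intro x k hx
    refine key _ (hcl.inv x k hx.closure_eq_top) fun e he => ?_
    have h0 := hx.eq_zero_of_prod_eq_one Function.injective_id
      (fun i => if i = k then -e i else e i) (by
        rw [← he]
        refine Finset.prod_congr rfl fun i _ => ?_
        rcases eq_or_ne i k with rfl | hi
        · simp
        · simp [hi])
    funext i
    have h1 := congrFun h0 i
    by_cases hi : i = k
    · simpa [hi] using h1
    · simpa [hi] using h1

/-- A substitution of basis elements with an inverse substitution extends to an automorphism, which
transports the basis. -/
theorem nielsenClosed_freeGroupBasis {r : ℕ} {K : Type*} [Group K] :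
    NielsenClosed fun h : Fin r → K => ∃ B : FreeGroupBasis (Fin r) K, ∀ i, B i = h i := by
  have key : ∀ (B : FreeGroupBasis (Fin r) K) (h' h'' : Fin r → K),
      (∀ i, B.lift h' (h'' i) = B i) → (∀ i, B.lift h'' (h' i) = B i) →
      ∃ B' : FreeGroupBasis (Fin r) K, ∀ i, B' i = h' i := by
    intro B h' h'' h1 h2
    have e : ∀ (f : Fin r → K) i, B.lift f (B i) = f i := fun f i =>
      congrFun (B.lift.symm_apply_apply f) i
    let θ : K ≃* K := MonoidHom.toMulEquiv (B.lift h') (B.lift h'')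
      (B.ext_hom _ _ fun i => by simp [e, h2]) (B.ext_hom _ _ fun i => by simp [e, h1])
    refine ⟨B.map θ, fun i => ?_⟩
    rw [FreeGroupBasis.map_apply]
    exact e h' i
  constructor
  · rintro h i j ⟨B, hB⟩
    refine ⟨B.reindex (Equiv.swap i j), fun k => ?_⟩
    rw [FreeGroupBasis.reindex_apply, Equiv.symm_swap, hB]
  · rintro h k c hc ⟨B, hB⟩
    obtain rfl : ⇑B = h := funext hB
    refine key B _ (fun i => B i * B k ^ (-c i)) (fun i => ?_) (fun i => ?_)
    · simp [hc]
    · simp [hc]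
  · rintro h k ⟨B, hB⟩
    obtain rfl : ⇑B = h := funext hB
    have h1 : ∀ i, B.lift (fun i => if i = k then (B i)⁻¹ else B i)
        (if i = k then (B i)⁻¹ else B i) = B i := by
      intro i
      by_cases hi : i = k
      · simp [hi]
      · simp [hi]
    exact key B _ _ h1 h1

end Nielsen

/-! ### Existence of the choices -/

theorem FreelyGeneratesAb.exists_eq_prod {ι V : Type*} [Fintype ι] [CommGroup V]
    {v : ι → V} (hv : FreelyGeneratesAb v) (a : V) : ∃ c : ι → ℤ, a = ∏ i, v i ^ c i := by
  classical
  obtain ⟨φ, hφ⟩ := hv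
  refine ⟨fun i => (φ a).toAdd i, φ.injective ?_⟩
  apply Multiplicative.toAdd.injective
  simp only [map_prod, map_zpow, hφ, toAdd_prod, toAdd_zpow, toAdd_ofAdd]
  ext j
  simp

/-- The stage whose generators are the members of a tuple, of which the first `s` form `y`. -/
def RelStage.ofTuple {F : Type*} {r s : ℕ} (h : Fin r → F) (hs : s ≤ r) : RelStage F where
  s := s
  t := r - s
  y i := h (Fin.castLE hs i)
  z i := h ⟨s + i, by omega⟩

/-- The indexing of the generators of `RelStage.ofTuple`. -/
def finSplit {r s : ℕ} (hs : s ≤ r) : Fin s ⊕ Fin (r - s) ≃ Fin r :=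
  finSumFinEquiv.trans (finCongr (Nat.add_sub_cancel' hs))

theorem RelStage.gens_ofTuple {F : Type*} {r s : ℕ} (h : Fin r → F) (hs : s ≤ r)
    (k : Fin s ⊕ Fin (r - s)) : (RelStage.ofTuple h hs).gens k = h (finSplit hs k) := by
  rcases k with i | i
  · rfl
  · rfl

theorem RelStage.range_gens_ofTuple {F : Type*} {r s : ℕ} (h : Fin r → F) (hs : s ≤ r) :
    Set.range (RelStage.ofTuple h hs).gens = Set.range h := by
  have : (RelStage.ofTuple h hs).gens = h ∘ finSplit hs := funext (gens_ofTuple h hs)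
  rw [this]
  exact (finSplit hs).surjective.range_comp h

/-- A tuple can be put into diagonal form by Nielsen transformations. -/
theorem exists_isDiagonal {F K K' : Type*} [Group F] [Group K] [Group K'] {n r m : ℕ}
    (f : K →* gam F n) (g : K' →* gam F n) {Q : (Fin r → K) → Prop} (hQ : NielsenClosed Q)
    {Q' : (Fin m → K') → Prop} (hQ' : NielsenClosed Q') {h : Fin r → K} {x : Fin m → K'}
    (hh : Q h) (hx : Q' x)
    (hfree : FreelyGeneratesAb fun j => (g (x j) : LowerCentralFactor F n)) :
    ∃ (h : Fin r → K) (x : Fin m → K') (s : ℕ) (hs : s ≤ r), Q h ∧ Q' x ∧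
      (RelStage.ofTuple (fun i => (f (h i) : F)) hs).IsDiagonal n (fun j => (g (x j) : F)) := by
  let π := QuotientGroup.mk' ((gam F (n + 1)).subgroupOf (gam F n))
  let p : gam F n →* LowerCentralFactor F n := π
  obtain ⟨s, d, h', x', hsr, hsm, hh', hx', hpos, hdvd, hy, hz⟩ :=
    hQ.exists_diagonal (p.comp f) (p.comp g) hQ' hh hx fun i => hfree.exists_eq_prod _
  refine ⟨h', x', s, hsr, hh', hx', hsm, fun i => d i, fun i => hpos i i.2,
    fun i j hij => hdvd i j hij j.2, fun i => ?_, fun i => ?_⟩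
  · have h1 : ((f (h' (Fin.castLE hsr i)) : gam F n) : LowerCentralFactor F n) =
        ((g (x' (Fin.castLE hsm i)) ^ d i : gam F n) : LowerCentralFactor F n) :=
      hy (Fin.castLE hsr i) i.2
    rw [QuotientGroup.eq, Subgroup.mem_subgroupOf] at h1
    exact h1
  · have h1 : ((f (h' ⟨s + i, by have : i.1 < r - s := i.2; omega⟩) : gam F n) :
        LowerCentralFactor F n) = 1 := hz _ (Nat.le_add_right _ _)
    rw [QuotientGroup.eq_one_iff, Subgroup.mem_subgroupOf] at h1
    exact h1

/-- The group surjects onto the free `ℤ`-module on `ι`, which is then finitely generated. -/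
theorem FreeGroupBasis.finite_of_fg {ι K : Type*} [Group K] (x : FreeGroupBasis ι K)
    (hK : Group.FG K) : Finite ι := by
  let f : K →* Multiplicative (ι →₀ ℤ) := x.lift fun i => Multiplicative.ofAdd (Finsupp.single i 1)
  have hf : Function.Surjective f := by
    intro a
    suffices h : ∀ a : ι →₀ ℤ, Multiplicative.ofAdd a ∈ f.range from h a.toAdd
    intro a
    induction a using Finsupp.induction_linear with
    | zero => exact one_mem _
    | add a b ha hb => exact mul_mem ha hb
    | single i k =>
      refine ⟨x i ^ k, ?_⟩
      have h1 : f (x i) = Multiplicative.ofAdd (Finsupp.single i 1) :=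
        congrFun (x.lift.symm_apply_apply _) i
      rw [map_zpow, h1, ← ofAdd_zsmul, Finsupp.smul_single, smul_eq_mul, mul_one]
  have h1 : Group.FG (Multiplicative (ι →₀ ℤ)) := Group.fg_of_surjective hf
  have h2 : AddGroup.FG (ι →₀ ℤ) := AddGroup.fg_iff_mul_fg.2 h1
  have h3 : Module.Finite ℤ (ι →₀ ℤ) := Module.Finite.iff_addGroup_fg.2 h2
  exact Module.Finite.finite_basis (Finsupp.basisSingleOne (R := ℤ) (ι := ι))

/-- `H_1` is free as a subgroup of a free group. The moves preserve free bases both of `H_1` and of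
`F`, as weight 1 demands. -/
theorem exists_isFirst {F : Type*} [Group F] {k : ℕ} (b : FreeGroupBasis (Fin k) F) {A : Set F}
    (hA : A.Finite) : ∃ (m : ℕ) (x : FreeGroupBasis (Fin m) F) (S : RelStage F), S.IsFirst A x := by
  have := b.isFreeGroup
  let H := Subgroup.closure A
  have hfg : Group.FG H := by
    rw [Group.fg_iff_subgroup_fg]
    exact ⟨hA.toFinset, by rw [hA.coe_toFinset]⟩
  let B := IsFreeGroup.basis H
  have hfin := B.finite_of_fg hfg
  have := Fintype.ofFinite (IsFreeGroup.Generators H)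
  let B' := B.reindex (Fintype.equivFin _)
  let g : F →* gam F 1 := (MonoidHom.id F).codRestrict (gam F 1) fun a => Subgroup.mem_top a
  obtain ⟨h, x, s, hs, ⟨B₁, hB₁⟩, ⟨x₁, hx₁⟩, hd⟩ := exists_isDiagonal (g.comp H.subtype) g
    (nielsenClosed_freeGroupBasis (r := Fintype.card (IsFreeGroup.Generators H)) (K := H))
    (nielsenClosed_freeGroupBasis (r := k) (K := F)) (h := B') (x := b) ⟨B', fun _ => rfl⟩
    ⟨b, fun _ => rfl⟩ b.freelyGeneratesAb
  refine ⟨k, x₁, RelStage.ofTuple (fun i => (h i : F)) hs,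
    ⟨B₁.reindex (finSplit hs).symm, fun k => ?_⟩, ?_⟩
  · refine Eq.trans ?_ (RelStage.gens_ofTuple (fun i => (h i : F)) hs k).symm
    exact congrArg Subtype.val (hB₁ (finSplit hs k))
  · obtain rfl : ⇑x₁ = x := funext hx₁
    exact hd

/-- Here the moves only need to preserve the subgroup generated by the finitely many `z_i` and
`[y_i, x_j]`, together with freeness of the family in the lower central factor. -/
theorem IsRelStage.exists_isNext {F : Type*} [Group F] {A : Set F} {m : ℕ}
    {x : FreeGroupBasis (Fin m) F} {n : ℕ} {S : RelStage F} (hS : IsRelStage A x n S) :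
    ∃ S' : RelStage F, S.IsNext x n S' := by
  obtain ⟨-, -, hz, hy, -⟩ := hS.invariant rfl
  let ι := Fin S.t ⊕ Fin S.s × Fin m
  let u : ι → gam F (n + 1) := Sum.elim (fun i => ⟨S.z i, hz i⟩) fun p =>
    ⟨leftComm (S.y p.1) (x p.2), by
      rw [leftComm_eq]
      exact commutator_mem_gam_succ (inv_mem (hy p.1)) _⟩
  have hu : Subgroup.closure (Set.range fun i => (u i : F)) = S.nextSubgroup x := by
    rw [RelStage.nextSubgroup]
    congr 1
    ext a
    constructor
    · rintro ⟨i | ⟨i, j⟩, rfl⟩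
      · exact Or.inl ⟨i, rfl⟩
      · exact Or.inr ⟨i, j, rfl⟩
    · rintro (⟨i, rfl⟩ | ⟨i, j, rfl⟩)
      · exact ⟨Sum.inl i, rfl⟩
      · exact ⟨Sum.inr (i, j), rfl⟩
  let σ := Fintype.equivFin ι
  obtain ⟨m', v, hv⟩ := x.exists_freelyGeneratesAb (Nat.le_add_left 1 n)
  let p : gam F (n + 1) →* LowerCentralFactor F (n + 1) := QuotientGroup.mk' _
  obtain ⟨h, x', s, hs, hh, hx', hd⟩ := exists_isDiagonal (MonoidHom.id (gam F (n + 1)))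
    (MonoidHom.id (gam F (n + 1)))
    (nielsenClosed_closure (r := Fintype.card ι) (gam F (n + 1)).subtype (S.nextSubgroup x))
    (nielsenClosed_freelyGeneratesAb p) (h := u ∘ σ.symm) (x := v)
    (by
      rw [← hu]
      congr 1
      exact σ.symm.surjective.range_comp fun i => (u i : F)) hv hv
  refine ⟨RelStage.ofTuple (fun i => (h i : F)) hs, ?_, m', x', hx', hd⟩
  rw [RelStage.range_gens_ofTuple]
  exact hh
-- The theorem
theorem mainTheorem2 {F : Type*} [Group F] {k : ℕ} (b : FreeGroupBasis (Fin k) F)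
    (A : Set F) (hA : A.Finite) (R : Subgroup F) [R.Normal] (hR : Subgroup.normalClosure A = R)
    {G : Type*} [Group G] (e : G ≃* F ⧸ R) :
    -- the construction can be started and can always be continued
    (∃ (m : ℕ) (x : FreeGroupBasis (Fin m) F) (S : RelStage F), IsRelStage A x 1 S) ∧
    (∀ (m : ℕ) (x : FreeGroupBasis (Fin m) F) (n : ℕ) (S : RelStage F), IsRelStage A x n S →
      ∃ S' : RelStage F, S.IsNext x n S') ∧
    -- however it is carried out, the `R`-basic commutators of weight `i` freely generate
    (∀ (m : ℕ) (x : FreeGroupBasis (Fin m) F) (i : ℕ) (S : RelStage F), IsRelStage A x i S →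
      ∃ hy : ∀ j, S.y j ∈ R ⊓ gam F i,
        FreelyGeneratesAb
          (fun j => ((⟨S.y j, hy j⟩ : (R ⊓ gam F i : Subgroup F)) : RelFactor R i))) ∧
    -- the lower central factors of `G`
    (∀ i : ℕ, 1 ≤ i →
      Function.Injective (relFactorIncl R i) ∧
      ∃ φ : (LowerCentralFactor F i ⧸ (relFactorIncl R i).range) ≃* LowerCentralFactor G i,
        ∀ (f : gam F i) (g : gam G i), e (g : G) = ((f : F) : F ⧸ R) →
          φ (((f : LowerCentralFactor F i)) : LowerCentralFactor F i ⧸ (relFactorIncl R i).range)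
            = (g : LowerCentralFactor G i)) := by

  refine ⟨?_, fun m x n S hS => hS.exists_isNext, fun m x i S hS => hS.freelyGeneratesAb hR,
    fun i _ => ⟨relFactorIncl_injective R i, exists_factor_mulEquiv R e i⟩⟩
  obtain ⟨m, x, S, hS⟩ := exists_isFirst b hA
  exact ⟨m, x, S, .first hS⟩
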